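/- **Setting.** Let $y_1<\dots<y_n$ be real numbers and $Y=\{y_1,\dots,y_n\}$. For an open set $U\subseteq\mathbb R$ with finite complement let $H^1(U;\mathbb C^d)$ be the space of all $f\in L^2(\mathbb R;\mathbb C^d)$ whose distributional derivative $f'$ on $U$ is in $L^2$, and $H^2(U;\mathbb C^d)=\{f\in H^1(U;\mathbb C^d): f'\in H^1(U;\mathbb C^d)\}$ (for $d=1$ we omit $\mathbb C^d$). For $f\in H^1(\mathbb R\setminus Y;\mathbb C^d)$ the one-sided limits $f(y_k^\pm)$ exist, and we put $\langle f\rangle_{y}=\frac12(f(y^-)+f(y^+))$ and $[f]_{y}=f(y^+)-f(y^-)$. Let $\sigma_1=\begin{bmatrix}0&1\\1&0\end{bmatrix}$, $\sigma_3=\begin{bmatrix}1&0\\0&-1\end{bmatrix}$. On $U$ let $\mathsf D_U\Psi=-i\sigma_1\Psi'+\frac12\sigma_3\Psi$ for $\Psi\in H^1(U;\mathbb C^2)$ and $\mathsf H_U\psi=-\psi''$ for $\psi\in H^2(U)$, with distributional derivatives on $U$. Let $\mathsf D=\mathsf D_{\mathbb R}$ and $\mathsf H=\mathsf H_{\mathbb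 R}$ be the free operators. For a linear map $\mathsf L$ we write $\mathsf L\mathbb 1=\mathsf L\oplus\mathsf L$, acting on the two components of $\Psi=(\psi_1,\psi_2)$. Define $$\tau,\rho:H^1(\mathbb R\setminus Y;\mathbb C^2)\to\mathbb C^{2n},\qquad \tau\Psi=(\langle\Psi\rangle_{y_k})_{k=1}^n,\qquad \rho\Psi=(i\sigma_1[\Psi]_{y_k})_{k=1}^n,$$ $$\widehat\tau,\widehat\rho:H^2(\mathbb R\setminus Y)\to\mathbb C^{2n},\qquad \widehat\tau\psi=(\langle\psi\rangle_{y_k}\oplus\langle\psi'\rangle_{y_k})_{k=1}^n,\qquad \widehat\rho\psi=([\psi']_{y_k}\oplus[-\psi]_{y_k})_{k=1}^n.$$ Let $(A,T)$ be one of $(\mathsf D,\tau)$, $(\mathsf H,\widehat\tau)$, $(\mathsf H\mathbb 1,\widehat\tau\mathbb 1)$, and let $N=2n,2n,4n$ respectively. Let $\Pi$ be an orthogonal projector in $\mathbb C^N$ and $\Theta:\operatorname{ran}\Pi\to\operatorname{ran}\Pi$ a symmetric operator. For $z\in\mathbb C\setminus\mathbb R$ let $G_z=(T(-A+\bar z)^{-1})^*:\mathbb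 C^N\to L^2$. The operator $A_{\Pi,\Theta}$ is the one with resolvent $$(-A_{\Pi,\Theta}+z)^{-1}=(-A+z)^{-1}+G_z\Pi(\Theta-\Pi TG_z\Pi)^{-1}\Pi G_{\bar z}^*,$$ where $\Pi$ also denotes the surjection onto $\operatorname{ran}\Pi$ and the injection of $\operatorname{ran}\Pi$. It is denoted $\mathsf D_{\Pi,\Theta}$, $\mathsf H_{\Pi,\Theta}$ and $\widehat{\mathsf H}_{\Pi,\Theta}$ in the three cases. **Theorem.** Let $(\Pi,\Theta)$ be as above in $\mathbb C^{2n}$, and let $(\widehat\Pi,\widehat\Theta)$ be such a pair in $\mathbb C^{4n}$. Then, whichever $z\in\mathbb C\setminus\mathbb R$ is used to define the operators, $$\operatorname{dom}(\mathsf D_{\Pi,\Theta})=\{\Psi\in H^1(\mathbb R\setminus Y;\mathbb C^2):\rho\Psi\in\operatorname{ran}\Pi,\ \Pi\tau\Psi=\Theta\rho\Psi\},\qquad \mathsf D_{\Pi,\Theta}\Psi=\mathsf D_{\mathbb R\setminus Y}\Psi,$$ $$\operatorname{dom}(\mathsf H_{\Pi,\Theta})=\{\psi\in H^2(\mathbb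 R\setminus Y):\widehat\rho\psi\in\operatorname{ran}\Pi,\ \Pi\widehat\tau\psi=\Theta\widehat\rho\psi\},\qquad \mathsf H_{\Pi,\Theta}\psi=\mathsf H_{\mathbb R\setminus Y}\psi,$$ $$\operatorname{dom}(\widehat{\mathsf H}_{\widehat\Pi,\widehat\Theta})=\{\Psi\in H^2(\mathbb R\setminus Y;\mathbb C^2):(\widehat\rho\mathbb 1)\Psi\in\operatorname{ran}\widehat\Pi,\ \widehat\Pi(\widehat\tau\mathbb 1)\Psi=\widehat\Theta(\widehat\rho\mathbb 1)\Psi\},\qquad \widehat{\mathsf H}_{\widehat\Pi,\widehat\Theta}\Psi=(\mathsf H_{\mathbb R\setminus Y}\mathbb 1)\Psi.$$ -/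

import Mathlib

open MeasureTheory Filter Topology Set
open scoped ContDiff InnerProductSpace

noncomputable section
namespace PointInteraction

/-- `L²(ℝ; E)`. -/
abbrev L2 (E : Type*) [NormedAddCommGroup E] := Lp E 2 (volume : Measure ℝ)

section Sobolev
variable {E : Type*} [NormedAddCommGroup E] [InnerProductSpace ℂ E]

/-- `f' = g` in the sense of distributions on the open set `U`, tested against
`C_c^∞(U; ℂ)`. -/
def IsWeakDeriv (U : Set ℝ) (f g : ℝ → E) : Prop :=
  ∀ φ : ℝ → ℂ, ContDiff ℝ ∞ φ → HasCompactSupport φ → tsupport φ ⊆ U →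
    ∫ x, deriv φ x • f x = - ∫ x, φ x • g x

theorem integrable_smul_L2 {φ : ℝ → ℂ} (h1 : Continuous φ) (h2 : HasCompactSupport φ)
    (f : L2 E) : Integrable (fun x => φ x • f x) := by
  have hl : LocallyIntegrable (f : ℝ → E) volume :=
    (Lp.memLp f).locallyIntegrable (by norm_num)
  exact hl.integrable_smul_left_of_hasCompactSupport h1 h2

/-- The pairs `(f, f')` with `f` and its distributional derivative on `U` both in `L²(ℝ; E)`
(in the sequel the complement of `U` is finite, so `L²(ℝ) = L²(U)`). -/
def weakDerivGraph (E : Type*) [NormedAddCommGroup E] [InnerProductSpace ℂ E] (U : Set ℝ) :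
    Submodule ℂ (L2 E × L2 E) where
  carrier := {p | IsWeakDeriv U p.1 p.2}
  zero_mem' := by
    intro φ h1 h2 h3
    have e : ((0 : L2 E) : ℝ → E) =ᵐ[volume] 0 := Lp.coeFn_zero _ _ _
    have e1 : ∫ x, deriv φ x • ((0 : L2 E) : ℝ → E) x = 0 := by
      rw [integral_eq_zero_of_ae]
      filter_upwards [e] with x hx
      simp only [hx, Pi.zero_apply, smul_zero]
    have e2 : ∫ x, φ x • ((0 : L2 E) : ℝ → E) x = 0 := by
      rw [integral_eq_zero_of_ae]
      filter_upwards [e] with x hx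
      simp only [hx, Pi.zero_apply, smul_zero]
    simp only [Prod.fst_zero, Prod.snd_zero]
    rw [e1, e2, neg_zero]
  add_mem' := by
    rintro ⟨f, f'⟩ ⟨g, g'⟩ hf hg φ h1 h2 h3
    have a1 := hf φ h1 h2 h3
    have a2 := hg φ h1 h2 h3
    have hd : Continuous (deriv φ) := h1.continuous_deriv (by simp)
    have hdc : HasCompactSupport (deriv φ) := h2.deriv
    simp only [Prod.mk_add_mk] at *
    have e1 : ∫ x, deriv φ x • ((f + g : L2 E) : ℝ → E) x =
        ∫ x, (deriv φ x • f x + deriv φ x • g x) := by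
      apply integral_congr_ae
      filter_upwards [Lp.coeFn_add f g] with x hx
      rw [hx, Pi.add_apply, smul_add]
    have e2 : ∫ x, φ x • ((f' + g' : L2 E) : ℝ → E) x =
        ∫ x, (φ x • f' x + φ x • g' x) := by
      apply integral_congr_ae
      filter_upwards [Lp.coeFn_add f' g'] with x hx
      rw [hx, Pi.add_apply, smul_add]
    rw [e1, e2, integral_add (integrable_smul_L2 hd hdc f) (integrable_smul_L2 hd hdc g),
      integral_add (integrable_smul_L2 h1.continuous h2 f')
        (integrable_smul_L2 h1.continuous h2 g'), a1, a2, neg_add]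
  smul_mem' := by
    rintro c ⟨f, f'⟩ hf φ h1 h2 h3
    have a1 := hf φ h1 h2 h3
    simp only [Prod.smul_mk] at *
    have e1 : ∫ x, deriv φ x • ((c • f : L2 E) : ℝ → E) x =
        ∫ x, c • (deriv φ x • f x) := by
      apply integral_congr_ae
      filter_upwards [Lp.coeFn_smul c f] with x hx
      simp [hx, smul_comm c]
    have e2 : ∫ x, φ x • ((c • f' : L2 E) : ℝ → E) x =
        ∫ x, c • (φ x • f' x) := by
      apply integral_congr_ae
      filter_upwards [Lp.coeFn_smul c f'] with x hx
      simp [hx, smul_comm c]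
    rw [e1, e2, integral_smul, integral_smul, a1, smul_neg]

/-- The distributional derivative on `U` as an operator in `L²`. Its graph really is the graph of
a function when `U` is open with null complement, see `weakDeriv_spec`. -/
def weakDeriv (E : Type*) [NormedAddCommGroup E] [InnerProductSpace ℂ E] (U : Set ℝ) :
    L2 E →ₗ.[ℂ] L2 E :=
  (weakDerivGraph E U).toLinearPMap

/-- The Sobolev space `H¹(U; E)`: for `U` the real line without finitely many points it is the
direct sum of the spaces `H¹` of the connected components of `U`. -/
def H1 (E : Type*) [NormedAddCommGroup E] [InnerProductSpace ℂ E] (U : Set ℝ) :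
    Submodule ℂ (L2 E) :=
  (weakDeriv E U).domain

/-- `f ↦ f'` on `H¹(U; E)`. -/
def derivH1 (U : Set ℝ) : H1 E U →ₗ[ℂ] L2 E := (weakDeriv E U).toFun

theorem mem_H1_iff {U : Set ℝ} {f : L2 E} : f ∈ H1 E U ↔ ∃ g : L2 E, IsWeakDeriv U f g := by
  constructor
  · rintro ⟨⟨f', g⟩, hp, rfl⟩
    exact ⟨g, hp⟩
  · rintro ⟨g, hg⟩
    exact ⟨(f, g), hg, rfl⟩

theorem H1_univ_le (U : Set ℝ) : H1 E univ ≤ H1 E U := by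
  intro f hf
  obtain ⟨g, hg⟩ := mem_H1_iff.1 hf
  exact mem_H1_iff.2 ⟨g, fun φ h1 h2 _ => hg φ h1 h2 (subset_univ _)⟩

theorem weakDeriv_functional [CompleteSpace E] {U : Set ℝ} (hU : IsOpen U) (h0 : volume Uᶜ = 0)
    (p : L2 E × L2 E) (hp : p ∈ weakDerivGraph E U) (hp1 : p.1 = 0) : p.2 = 0 := by
  obtain ⟨f, g⟩ := p
  simp only at hp1
  subst hp1
  have hl : LocallyIntegrable (g : ℝ → E) volume :=
    (Lp.memLp g).locallyIntegrable (by norm_num)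
  have key := hU.ae_eq_zero_of_integral_contDiff_smul_eq_zero
    (hl.locallyIntegrableOn U) (fun φ h1 h2 h3 => by
      have h4 := hp (fun x => (φ x : ℂ)) (Complex.ofRealCLM.contDiff.comp h1)
        (h2.comp_left (g := fun x : ℝ => (x : ℂ)) (by simp))
        ((tsupport_comp_subset (g := fun x : ℝ => (x : ℂ)) (by simp) φ).trans h3)
      have e1 : ∫ x, deriv (fun x => (φ x : ℂ)) x • ((0 : L2 E) : ℝ → E) x = 0 := by
        rw [integral_eq_zero_of_ae]
        filter_upwards [Lp.coeFn_zero E 2 (volume : Measure ℝ)] with x hx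
        simp only [hx, Pi.zero_apply, smul_zero]
      simp only at h4
      rw [e1, eq_comm, neg_eq_zero] at h4
      simpa using h4)
  apply Lp.eq_zero_iff_ae_eq_zero.2
  have h0' : ∀ᵐ x ∂(volume : Measure ℝ), x ∈ U := by
    rw [ae_iff]; exact h0
  filter_upwards [key, h0'] with x hx hx'
  exact hx hx'

theorem weakDeriv_spec [CompleteSpace E] {U : Set ℝ} (hU : IsOpen U) (h0 : volume Uᶜ = 0)
    (f : H1 E U) : IsWeakDeriv U (f : L2 E) (weakDeriv E U f) :=
  Submodule.mem_graph_toLinearPMap (weakDeriv_functional hU h0) f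

theorem ae_const_of_weakDeriv_zero [CompleteSpace E] {a b : ℝ} (hab : a < b) {h : ℝ → E}
    (hl : LocallyIntegrable h volume)
    (H : ∀ φ : ℝ → ℝ, ContDiff ℝ ∞ φ → HasCompactSupport φ → tsupport φ ⊆ Ioo a b →
      ∫ x, deriv φ x • h x = 0) :
    ∃ c, ∀ᵐ x, x ∈ Ioo a b → h x = c := by
  have hm : (a + b) / 2 ∈ Ioo a b := ⟨by linarith, by linarith⟩
  obtain ⟨η, hη1, hη2, hη3, hη4, hη5⟩ :=
    exists_contDiff_tsupport_subset (n := (⊤ : ℕ∞)) (isOpen_Ioo.mem_nhds hm)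
  have hηpos : 0 < ∫ x, η x :=
    hη3.continuous.integral_pos_of_hasCompactSupport_nonneg_nonzero hη2
      (fun x => (hη4 ⟨x, rfl⟩).1) (x := (a + b) / 2) (by rw [hη5]; exact one_ne_zero)
  refine ⟨(∫ x, η x)⁻¹ • ∫ x, η x • h x, ?_⟩
  set c : E := (∫ x, η x)⁻¹ • ∫ x, η x • h x with hc
  have hl' : LocallyIntegrable (fun x => h x - c) volume := hl.sub (locallyIntegrable_const c)
  have key := (isOpen_Ioo (a := a) (b := b)).ae_eq_zero_of_integral_contDiff_smul_eq_zero
    (hl'.locallyIntegrableOn _) (fun ψ h1 h2 h3 => ?_)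
  · filter_upwards [key] with x hx hx'
    exact sub_eq_zero.1 (hx hx')
  set m : ℝ := (∫ x, ψ x) * (∫ x, η x)⁻¹ with hmdef
  have iψ : Integrable ψ := h1.continuous.integrable_of_hasCompactSupport h2
  have iη : Integrable η := hη3.continuous.integrable_of_hasCompactSupport hη2
  have iψh : Integrable (fun x => ψ x • h x) :=
    hl.integrable_smul_left_of_hasCompactSupport h1.continuous h2
  have iηh : Integrable (fun x => η x • h x) :=
    hl.integrable_smul_left_of_hasCompactSupport hη3.continuous hη2
  let k : ℝ → ℝ := fun x => ψ x - m * η x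
  have hk : ContDiff ℝ ∞ k := h1.sub (contDiff_const.mul hη3)
  have ik : Integrable k := iψ.sub (iη.const_mul m)
  have ik0 : ∫ x, k x = 0 := by
    have : ∫ x, k x = (∫ x, ψ x) - ∫ x, m * η x := integral_sub iψ (iη.const_mul m)
    rw [this, integral_const_mul, hmdef]
    field_simp
    ring
  let K : Set ℝ := tsupport ψ ∪ tsupport η
  have hK : IsCompact K := h2.isCompact.union hη2.isCompact
  have hKne : K.Nonempty := ⟨(a + b) / 2, Or.inr (subset_tsupport _ (by
    rw [Function.mem_support, hη5]; exact one_ne_zero))⟩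
  have hKab : K ⊆ Ioo a b := union_subset h3 hη1
  obtain ⟨a', ha', hla⟩ := hK.exists_isLeast hKne
  obtain ⟨b', hb', hlb⟩ := hK.exists_isGreatest hKne
  have hk0 : ∀ x, x ∉ K → k x = 0 := by
    intro x hx
    have u1 : ψ x = 0 := image_eq_zero_of_notMem_tsupport fun h => hx (Or.inl h)
    have u2 : η x = 0 := image_eq_zero_of_notMem_tsupport fun h => hx (Or.inr h)
    simp [k, u1, u2]
  let φ : ℝ → ℝ := fun x => ∫ t in Iic x, k t
  have hφ' : ∀ x, HasDerivAt φ (k x) x := by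
    intro x
    have e : φ = fun x => φ 0 + ∫ t in (0 : ℝ)..x, k t := by
      funext y
      have := intervalIntegral.integral_Iic_sub_Iic (μ := volume) (f := k) (a := 0) (b := y)
        ik.integrableOn ik.integrableOn
      rw [← this]
      simp [φ]
    rw [e]
    exact (intervalIntegral.integral_hasDerivAt_right (ik.intervalIntegrable)
      (hk.continuous.stronglyMeasurableAtFilter _ _) hk.continuous.continuousAt).const_add _
  have hdφ : deriv φ = k := funext fun x => (hφ' x).deriv
  have hφc : ContDiff ℝ ∞ φ := by
    rw [contDiff_infty_iff_deriv]
    exact ⟨fun x => (hφ' x).differentiableAt, by rw [hdφ]; exact hk⟩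
  have hφs : tsupport φ ⊆ Icc a' b' := by
    apply closure_minimal _ isClosed_Icc
    intro x hx
    by_contra hx'
    apply hx
    rw [mem_Icc, not_and_or, not_le, not_le] at hx'
    rcases hx' with hx' | hx'
    · apply setIntegral_eq_zero_of_forall_eq_zero
      intro t ht
      exact hk0 t fun htK => absurd (hla htK) (not_le.2 (lt_of_le_of_lt ht hx'))
    · change ∫ t in Iic x, k t = 0
      rw [setIntegral_eq_integral_of_forall_compl_eq_zero, ik0]
      intro t ht
      exact hk0 t fun htK => ht ((hlb htK).trans hx'.le)
  have hφk : HasCompactSupport φ := isCompact_Icc.of_isClosed_subset (isClosed_tsupport _) hφs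
  have hfin := H φ hφc hφk (hφs.trans fun x hx =>
    ⟨(hKab ha').1.trans_le hx.1, hx.2.trans_lt (hKab hb').2⟩)
  rw [hdφ] at hfin
  have e1 : ∫ x, k x • h x = (∫ x, ψ x • h x) - m • ∫ x, η x • h x := by
    have e3 : ∀ x, k x • h x = ψ x • h x - m • (η x • h x) := fun x => by
      simp only [k, sub_smul, mul_smul]
    simp only [e3]
    rw [← integral_smul]
    exact integral_sub iψh (iηh.smul m)
  have e2 : ∫ x, ψ x • (h x - c) = (∫ x, ψ x • h x) - (∫ x, ψ x) • c := by
    simp only [smul_sub]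
    rw [integral_sub iψh (iψ.smul_const c), integral_smul_const]
  rw [e2, hc, smul_smul, ← hmdef, ← e1, hfin]

theorem integral_deriv_smul_primitive [CompleteSpace E] {G : ℝ → E} (hG : Integrable G)
    {φ : ℝ → ℝ} (h1 : ContDiff ℝ ∞ φ) (h2 : HasCompactSupport φ) :
    ∫ x, deriv φ x • (∫ t in Iic x, G t) = - ∫ x, φ x • G x := by
  have hd : Continuous (deriv φ) := h1.continuous_deriv (by simp)
  have id : Integrable (deriv φ) := hd.integrable_of_hasCompactSupport h2.deriv
  let f : ℝ → ℝ → E := fun x t => (Iic x).indicator (fun t => deriv φ x • G t) t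
  have hf : Integrable (Function.uncurry f) (volume.prod volume) := by
    have := (id.smul_prod hG).indicator (s := {z : ℝ × ℝ | z.2 ≤ z.1})
      (measurableSet_le measurable_snd measurable_fst)
    refine this.congr (Eventually.of_forall fun z => ?_)
    obtain ⟨x, t⟩ := z
    simp only [Function.uncurry, f, indicator, mem_ofPred_eq, mem_Iic]
  have hs := integral_integral_swap hf
  have e1 : ∀ x, ∫ t, f x t = deriv φ x • (∫ t in Iic x, G t) := by
    intro x
    simp only [f]
    rw [integral_indicator measurableSet_Iic, integral_smul]
  have e2 : ∀ t, ∫ x, f x t = (- φ t) • G t := by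
    intro t
    have : ∀ x, f x t = (Ici t).indicator (fun x => deriv φ x • G t) x := by
      intro x
      simp only [f, indicator, mem_Iic, mem_Ici]
    simp only [this]
    rw [integral_indicator measurableSet_Ici, integral_smul_const, integral_Ici_eq_integral_Ioi,
      h2.integral_Ioi_deriv_eq (h1.of_le (by simp))]
  simp only [e1, e2] at hs
  rw [hs, ← integral_neg]
  simp only [neg_smul]

/-- A function in `H¹` has a continuous representative on every open interval inside `U`, which
extends continuously to the end points. -/
theorem exists_primitive_of_isWeakDeriv [CompleteSpace E] {U : Set ℝ} {f g : L2 E}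
    (hfg : IsWeakDeriv U f g) {a b : ℝ} (hab : a < b) (hU : Ioo a b ⊆ U) :
    ∃ F : ℝ → E, Continuous F ∧ ∀ᵐ x, x ∈ Ioo a b → f x = F x := by
  have hlf : LocallyIntegrable (f : ℝ → E) volume :=
    (Lp.memLp f).locallyIntegrable (by norm_num)
  have hlg : LocallyIntegrable (g : ℝ → E) volume :=
    (Lp.memLp g).locallyIntegrable (by norm_num)
  have hg : IntegrableOn (g : ℝ → E) (Ioo a b) :=
    (hlg.integrableOn_isCompact isCompact_Icc).mono_set Ioo_subset_Icc_self
  let G : ℝ → E := (Ioo a b).indicator g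
  have hG : Integrable G := hg.integrable_indicator measurableSet_Ioo
  let P : ℝ → E := fun x => ∫ t in Iic x, G t
  have hP : Continuous P := by
    have e : P = fun x => P 0 + ∫ t in (0 : ℝ)..x, G t := by
      funext y
      have := intervalIntegral.integral_Iic_sub_Iic (μ := volume) (f := G) (a := 0) (b := y)
        hG.integrableOn hG.integrableOn
      rw [← this]
      simp [P]
    rw [e]
    exact continuous_const.add
      (intervalIntegral.continuous_primitive (fun _ _ => hG.intervalIntegrable) 0)
  obtain ⟨c, hc⟩ := ae_const_of_weakDeriv_zero hab (h := fun x => f x - P x)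
    (hlf.sub hP.locallyIntegrable) (fun φ h1 h2 h3 => by
      have hd : Continuous (deriv φ) := h1.continuous_deriv (by simp)
      have i1 : Integrable (fun x => deriv φ x • f x) :=
        hlf.integrable_smul_left_of_hasCompactSupport hd h2.deriv
      have i2 : Integrable (fun x => deriv φ x • P x) :=
        hP.locallyIntegrable.integrable_smul_left_of_hasCompactSupport hd h2.deriv
      simp only [smul_sub]
      rw [integral_sub i1 i2, integral_deriv_smul_primitive hG h1 h2]
      have h4 := hfg (fun x => (φ x : ℂ)) (Complex.ofRealCLM.contDiff.comp h1)
        (h2.comp_left (g := fun x : ℝ => (x : ℂ)) (by simp))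
        ((tsupport_comp_subset (g := fun x : ℝ => (x : ℂ)) (by simp) φ).trans (h3.trans hU))
      have e1 : ∀ x, deriv (fun x => (φ x : ℂ)) x = ((deriv φ x : ℝ) : ℂ) := fun x =>
        ((((h1.differentiable (by simp)) x).hasDerivAt).ofReal_comp).deriv
      simp only [e1, Complex.coe_smul] at h4
      have e2 : ∫ x, φ x • G x = ∫ x, φ x • g x := by
        congr 1
        funext x
        by_cases hx : x ∈ Ioo a b
        · simp only [G, indicator_of_mem hx]
        · rw [image_eq_zero_of_notMem_tsupport fun h => hx (h3 h), zero_smul, zero_smul]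
      rw [h4, e2, sub_self])
  refine ⟨fun x => c + P x, continuous_const.add hP, ?_⟩
  filter_upwards [hc] with x hx hx'
  rw [← hx hx', sub_add_cancel]

end Sobolev

section Traces
variable {E : Type*} [NormedAddCommGroup E] [InnerProductSpace ℂ E]

/-- The one-sided limit `f(y⁺)`; null sets are disregarded, so it depends only on the class of `f`. -/
def limRight (f : ℝ → E) (y : ℝ) : E := limUnder (𝓝[>] y ⊓ ae volume) f

/-- The one-sided limit `f(y⁻)`; null sets are disregarded, so it depends only on the class of `f`. -/
def limLeft (f : ℝ → E) (y : ℝ) : E := limUnder (𝓝[<] y ⊓ ae volume) f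

instance neBot_right (y : ℝ) : (𝓝[>] y ⊓ ae (volume : Measure ℝ)).NeBot := by
  rw [Filter.inf_neBot_iff]
  intro s hs t ht
  obtain ⟨u, hu, hus⟩ := mem_nhdsGT_iff_exists_Ioo_subset.1 hs
  by_contra hne
  rw [not_nonempty_iff_eq_empty, ← disjoint_iff_inter_eq_empty] at hne
  have h0 : volume (Ioo y u) = 0 :=
    measure_mono_null (hus.trans hne.subset_compl_right) (mem_ae_iff.1 ht)
  rw [Real.volume_Ioo, ENNReal.ofReal_eq_zero] at h0
  have : y < u := hu
  linarith

instance neBot_left (y : ℝ) : (𝓝[<] y ⊓ ae (volume : Measure ℝ)).NeBot := by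
  rw [Filter.inf_neBot_iff]
  intro s hs t ht
  obtain ⟨u, hu, hus⟩ := mem_nhdsLT_iff_exists_Ioo_subset.1 hs
  by_contra hne
  rw [not_nonempty_iff_eq_empty, ← disjoint_iff_inter_eq_empty] at hne
  have h0 : volume (Ioo u y) = 0 :=
    measure_mono_null (hus.trans hne.subset_compl_right) (mem_ae_iff.1 ht)
  rw [Real.volume_Ioo, ENNReal.ofReal_eq_zero] at h0
  have : u < y := hu
  linarith

/-- The right limits of a function in `H¹(ℝ ∖ S)` exist, `S` a finite set. -/
theorem tendsto_right [CompleteSpace E] {S : Set ℝ} (hS : S.Finite) {f : L2 E}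
    (hf : f ∈ H1 E Sᶜ) (y : ℝ) :
    Tendsto f (𝓝[>] y ⊓ ae volume) (𝓝 (limRight f y)) := by
  obtain ⟨g, hg⟩ := mem_H1_iff.1 hf
  have hn : (S \ {y})ᶜ ∈ 𝓝 y := (hS.subset sdiff_subset).isClosed.isOpen_compl.mem_nhds (by simp)
  obtain ⟨u, hu, hus⟩ := mem_nhdsGT_iff_exists_Ioo_subset.1 (mem_nhdsWithin_of_mem_nhds hn)
  obtain ⟨F, hF, hfF⟩ := exists_primitive_of_isWeakDeriv hg (mem_Ioi.1 hu)
    (fun x hx hxS => hus hx ⟨hxS, hx.1.ne'⟩)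
  refine tendsto_nhds_limUnder ⟨F y, ?_⟩
  have h1 : Tendsto F (𝓝[>] y ⊓ ae volume) (𝓝 (F y)) :=
    hF.continuousAt.mono_left (inf_le_left.trans nhdsWithin_le_nhds)
  refine h1.congr' ?_
  have h2 : ∀ᶠ x in 𝓝[>] y ⊓ ae volume, x ∈ Ioo y u :=
    Filter.mem_inf_of_left (Ioo_mem_nhdsGT hu)
  have h3 : ∀ᶠ x in 𝓝[>] y ⊓ ae volume, x ∈ Ioo y u → f x = F x :=
    Filter.mem_inf_of_right hfF
  filter_upwards [h2, h3] with x hx hx'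
  exact (hx' hx).symm

/-- The left limits of a function in `H¹(ℝ ∖ S)` exist, `S` a finite set. -/
theorem tendsto_left [CompleteSpace E] {S : Set ℝ} (hS : S.Finite) {f : L2 E}
    (hf : f ∈ H1 E Sᶜ) (y : ℝ) :
    Tendsto f (𝓝[<] y ⊓ ae volume) (𝓝 (limLeft f y)) := by
  obtain ⟨g, hg⟩ := mem_H1_iff.1 hf
  have hn : (S \ {y})ᶜ ∈ 𝓝 y := (hS.subset sdiff_subset).isClosed.isOpen_compl.mem_nhds (by simp)
  obtain ⟨u, hu, hus⟩ := mem_nhdsLT_iff_exists_Ioo_subset.1 (mem_nhdsWithin_of_mem_nhds hn)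
  obtain ⟨F, hF, hfF⟩ := exists_primitive_of_isWeakDeriv hg (mem_Iio.1 hu)
    (fun x hx hxS => hus hx ⟨hxS, hx.2.ne⟩)
  refine tendsto_nhds_limUnder ⟨F y, ?_⟩
  have h1 : Tendsto F (𝓝[<] y ⊓ ae volume) (𝓝 (F y)) :=
    hF.continuousAt.mono_left (inf_le_left.trans nhdsWithin_le_nhds)
  refine h1.congr' ?_
  have h2 : ∀ᶠ x in 𝓝[<] y ⊓ ae volume, x ∈ Ioo u y :=
    Filter.mem_inf_of_left (Ioo_mem_nhdsLT hu)
  have h3 : ∀ᶠ x in 𝓝[<] y ⊓ ae volume, x ∈ Ioo u y → f x = F x :=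
    Filter.mem_inf_of_right hfF
  filter_upwards [h2, h3] with x hx hx'
  exact (hx' hx).symm

theorem limRight_add [CompleteSpace E] {S : Set ℝ} (hS : S.Finite) (f g : H1 E Sᶜ) (y : ℝ) :
    limRight ((f : L2 E) + (g : L2 E) : L2 E) y = limRight (f : L2 E) y + limRight (g : L2 E) y := by
  refine Tendsto.limUnder_eq (Tendsto.congr' ?_
    ((tendsto_right hS f.2 y).add (tendsto_right hS g.2 y)))
  filter_upwards [Filter.mem_inf_of_right (Lp.coeFn_add (f : L2 E) (g : L2 E))] with x hx
  exact hx.symm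

theorem limRight_smul [CompleteSpace E] {S : Set ℝ} (hS : S.Finite) (c : ℂ) (f : H1 E Sᶜ) (y : ℝ) :
    limRight (c • (f : L2 E) : L2 E) y = c • limRight (f : L2 E) y := by
  refine Tendsto.limUnder_eq (Tendsto.congr' ?_ ((tendsto_right hS f.2 y).const_smul c))
  filter_upwards [Filter.mem_inf_of_right (Lp.coeFn_smul c (f : L2 E))] with x hx
  exact hx.symm

theorem limLeft_add [CompleteSpace E] {S : Set ℝ} (hS : S.Finite) (f g : H1 E Sᶜ) (y : ℝ) :
    limLeft ((f : L2 E) + (g : L2 E) : L2 E) y = limLeft (f : L2 E) y + limLeft (g : L2 E) y := by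
  refine Tendsto.limUnder_eq (Tendsto.congr' ?_
    ((tendsto_left hS f.2 y).add (tendsto_left hS g.2 y)))
  filter_upwards [Filter.mem_inf_of_right (Lp.coeFn_add (f : L2 E) (g : L2 E))] with x hx
  exact hx.symm

theorem limLeft_smul [CompleteSpace E] {S : Set ℝ} (hS : S.Finite) (c : ℂ) (f : H1 E Sᶜ) (y : ℝ) :
    limLeft (c • (f : L2 E) : L2 E) y = c • limLeft (f : L2 E) y := by
  refine Tendsto.limUnder_eq (Tendsto.congr' ?_ ((tendsto_left hS f.2 y).const_smul c))
  filter_upwards [Filter.mem_inf_of_right (Lp.coeFn_smul c (f : L2 E))] with x hx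
  exact hx.symm

variable [CompleteSpace E] {S : Set ℝ}

/-- The average `⟨f⟩_y = (f(y⁻) + f(y⁺)) / 2`. -/
def average (hS : S.Finite) (y : ℝ) : H1 E Sᶜ →ₗ[ℂ] E where
  toFun f := (1 / 2 : ℂ) • (limLeft (f : L2 E) y + limRight (f : L2 E) y)
  map_add' f g := by
    rw [Submodule.coe_add, limLeft_add hS, limRight_add hS, ← smul_add]
    congr 1
    abel
  map_smul' c f := by
    rw [Submodule.coe_smul, limLeft_smul hS, limRight_smul hS, ← smul_add, smul_comm]
    rfl

/-- The jump `[f]_y = f(y⁺) - f(y⁻)`. -/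
def jump (hS : S.Finite) (y : ℝ) : H1 E Sᶜ →ₗ[ℂ] E where
  toFun f := limRight (f : L2 E) y - limLeft (f : L2 E) y
  map_add' f g := by
    rw [Submodule.coe_add, limLeft_add hS, limRight_add hS]
    abel
  map_smul' c f := by
    rw [Submodule.coe_smul, limLeft_smul hS, limRight_smul hS, ← smul_sub]
    rfl

end Traces

section SecondOrder
variable (E : Type*) [NormedAddCommGroup E] [InnerProductSpace ℂ E]

/-- The Sobolev space `H²(U; E)` of all `f ∈ H¹(U; E)` with `f' ∈ H¹(U; E)`. -/
def H2 (U : Set ℝ) : Submodule ℂ (L2 E) :=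
  ((H1 E U).comap (weakDeriv E U).toFun).map (H1 E U).subtype

variable {E}

theorem mem_H2_iff {U : Set ℝ} {f : L2 E} :
    f ∈ H2 E U ↔ ∃ h : f ∈ H1 E U, weakDeriv E U ⟨f, h⟩ ∈ H1 E U := by
  constructor
  · rintro ⟨g, hg, rfl⟩
    exact ⟨g.2, hg⟩
  · rintro ⟨h, hf⟩
    exact ⟨⟨f, h⟩, hf, rfl⟩

theorem H2_le_H1 (U : Set ℝ) : H2 E U ≤ H1 E U := fun _ hf => (mem_H2_iff.1 hf).1

/-- `f ↦ f'` as a map from `H²(U; E)` to `H¹(U; E)`. -/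
def derivH2 (U : Set ℝ) : H2 E U →ₗ[ℂ] H1 E U :=
  ((weakDeriv E U).toFun.comp (Submodule.inclusion (H2_le_H1 U))).codRestrict (H1 E U)
    (fun f => (mem_H2_iff.1 f.2).2)

theorem H2_univ_le [CompleteSpace E] {U : Set ℝ} (hU : IsOpen U) (h0 : volume Uᶜ = 0) :
    H2 E univ ≤ H2 E U := by
  intro f hf
  obtain ⟨h1, h2⟩ := mem_H2_iff.1 hf
  have h3 : IsWeakDeriv U f (weakDeriv E univ ⟨f, h1⟩) := fun φ a b _ =>
    weakDeriv_spec isOpen_univ (by simp) ⟨f, h1⟩ φ a b (subset_univ _)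
  have h4 : weakDeriv E U ⟨f, H1_univ_le U h1⟩ = weakDeriv E univ ⟨f, h1⟩ := by
    have h5 := (weakDerivGraph E U).sub_mem
      (show (f, weakDeriv E U ⟨f, H1_univ_le U h1⟩) ∈ weakDerivGraph E U from
        weakDeriv_spec hU h0 ⟨f, H1_univ_le U h1⟩)
      (show (f, weakDeriv E univ ⟨f, h1⟩) ∈ weakDerivGraph E U from h3)
    exact sub_eq_zero.1 (weakDeriv_functional hU h0 _ h5 (sub_self f))
  refine mem_H2_iff.2 ⟨H1_univ_le U h1, ?_⟩
  rw [h4]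
  exact H1_univ_le U h2

end SecondOrder

section Operators

/-- `ℂ²`. -/
abbrev C2 := EuclideanSpace ℂ (Fin 2)

/-- The Pauli matrix `σ₁`. -/
def sigma1 : Matrix (Fin 2) (Fin 2) ℂ := !![0, 1; 1, 0]

/-- The Pauli matrix `σ₃`. -/
def sigma3 : Matrix (Fin 2) (Fin 2) ℂ := !![1, 0; 0, -1]

/-- Pointwise multiplication by a constant matrix in `L²(ℝ; ℂ²)`. -/
def matrixL2 (A : Matrix (Fin 2) (Fin 2) ℂ) : L2 C2 →ₗ[ℂ] L2 C2 :=
  ((Matrix.toEuclideanCLM (n := Fin 2) (𝕜 := ℂ) A).compLpL 2 volume).toLinearMap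

/-- The Dirac operator `-i σ₁ d/dx + σ₃/2`, derivatives being distributional on `U`, with domain
`H¹(U; ℂ²)`. For `U = ℝ` it is the free Dirac operator. -/
def diracOp (U : Set ℝ) : L2 C2 →ₗ.[ℂ] L2 C2 where
  domain := H1 C2 U
  toFun := (-Complex.I) • (matrixL2 sigma1).comp (derivH1 U) +
    (1 / 2 : ℂ) • (matrixL2 sigma3).comp (H1 C2 U).subtype

/-- The Schrödinger operator `-d²/dx²`, derivatives being distributional on `U`, with domain
`H²(U; E)`. For `U = ℝ` and `E = ℂ` it is the free Schrödinger operator `H`, and for `E = ℂ²` it is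
`H ⊕ H`. -/
def schrodingerOp (E : Type*) [NormedAddCommGroup E] [InnerProductSpace ℂ E] (U : Set ℝ) :
    L2 E →ₗ.[ℂ] L2 E where
  domain := H2 E U
  toFun := -((weakDeriv E U).toFun.comp (derivH2 U))

end Operators

section BoundaryMaps
variable {n : ℕ} (Y : Fin n → ℝ)

/-- `ℝ ∖ {y₁, …, yₙ}`. -/
def punctured : Set ℝ := (Set.range Y)ᶜ

theorem isOpen_punctured : IsOpen (punctured Y) := (Set.finite_range Y).isClosed.isOpen_compl

theorem volume_compl_punctured : volume (punctured Y)ᶜ = 0 := by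
  rw [punctured, compl_compl]
  exact (Set.finite_range Y).measure_zero _

/-- `⟨f⟩` at the `k`-th point. -/
def averageAt (E : Type*) [NormedAddCommGroup E] [InnerProductSpace ℂ E] [CompleteSpace E] (k : Fin n) :
    H1 E (punctured Y) →ₗ[ℂ] E :=
  average (Set.finite_range Y) (Y k)

/-- `[f]` at the `k`-th point. -/
def jumpAt (E : Type*) [NormedAddCommGroup E] [InnerProductSpace ℂ E] [CompleteSpace E] (k : Fin n) :
    H1 E (punctured Y) →ₗ[ℂ] E :=
  jump (Set.finite_range Y) (Y k)

/-- `τΨ = (⟨Ψ⟩_{y₁}, …, ⟨Ψ⟩_{yₙ}) ∈ ℂ²ⁿ`. -/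
def tauD : H1 C2 (punctured Y) →ₗ[ℂ] EuclideanSpace ℂ (Fin n × Fin 2) where
  toFun Ψ := WithLp.toLp 2 fun p => averageAt Y C2 p.1 Ψ p.2
  map_add' _ _ := by ext p; simp
  map_smul' _ _ := by ext p; simp

/-- `ρΨ = (iσ₁[Ψ]_{y₁}, …, iσ₁[Ψ]_{yₙ}) ∈ ℂ²ⁿ`. -/
def rhoD : H1 C2 (punctured Y) →ₗ[ℂ] EuclideanSpace ℂ (Fin n × Fin 2) where
  toFun Ψ := WithLp.toLp 2 fun p =>
    (Complex.I • Matrix.toEuclideanLin sigma1 (jumpAt Y C2 p.1 Ψ)) p.2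
  map_add' _ _ := by ext p; simp
  map_smul' _ _ := by ext p; simp [mul_left_comm]

/-- The map `τ̂` on `H²(ℝ ∖ Y)`, with blocks `⟨ψ⟩_{y_k} ⊕ ⟨ψ'⟩_{y_k}`. -/
def tauH : H2 ℂ (punctured Y) →ₗ[ℂ] EuclideanSpace ℂ (Fin n × Fin 2) where
  toFun ψ := WithLp.toLp 2 fun p =>
    ![averageAt Y ℂ p.1 (Submodule.inclusion (H2_le_H1 _) ψ), averageAt Y ℂ p.1 (derivH2 _ ψ)] p.2
  map_add' _ _ := by ext ⟨k, j⟩; fin_cases j <;> simp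
  map_smul' _ _ := by ext ⟨k, j⟩; fin_cases j <;> simp

/-- The map `ρ̂` on `H²(ℝ ∖ Y)`, with blocks `[ψ']_{y_k} ⊕ [-ψ]_{y_k}`. -/
def rhoH : H2 ℂ (punctured Y) →ₗ[ℂ] EuclideanSpace ℂ (Fin n × Fin 2) where
  toFun ψ := WithLp.toLp 2 fun p =>
    ![jumpAt Y ℂ p.1 (derivH2 _ ψ), -jumpAt Y ℂ p.1 (Submodule.inclusion (H2_le_H1 _) ψ)] p.2
  map_add' _ _ := by ext ⟨k, j⟩; fin_cases j <;> simp [-neg_add_rev, neg_add]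
  map_smul' _ _ := by ext ⟨k, j⟩; fin_cases j <;> simp

/-- `τ̂ ⊕ τ̂` on `H²(ℝ ∖ Y; ℂ²)`, with values in `ℂ²ⁿ ⊕ ℂ²ⁿ`; the first index is the component of
`Ψ = (ψ₁, ψ₂)`. -/
def tauHH : H2 C2 (punctured Y) →ₗ[ℂ] EuclideanSpace ℂ (Fin 2 × Fin n × Fin 2) where
  toFun Ψ := WithLp.toLp 2 fun p =>
    ![averageAt Y C2 p.2.1 (Submodule.inclusion (H2_le_H1 _) Ψ) p.1,
      averageAt Y C2 p.2.1 (derivH2 _ Ψ) p.1] p.2.2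
  map_add' _ _ := by ext ⟨c, k, j⟩; fin_cases j <;> simp
  map_smul' _ _ := by ext ⟨c, k, j⟩; fin_cases j <;> simp

/-- `ρ̂ ⊕ ρ̂` on `H²(ℝ ∖ Y; ℂ²)`, with values in `ℂ²ⁿ ⊕ ℂ²ⁿ`; the first index is the component of
`Ψ = (ψ₁, ψ₂)`. -/
def rhoHH : H2 C2 (punctured Y) →ₗ[ℂ] EuclideanSpace ℂ (Fin 2 × Fin n × Fin 2) where
  toFun Ψ := WithLp.toLp 2 fun p =>
    ![jumpAt Y C2 p.2.1 (derivH2 _ Ψ) p.1,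
      -jumpAt Y C2 p.2.1 (Submodule.inclusion (H2_le_H1 _) Ψ) p.1] p.2.2
  map_add' _ _ := by ext ⟨c, k, j⟩; fin_cases j <;> simp [-neg_add_rev, neg_add]
  map_smul' _ _ := by ext ⟨c, k, j⟩; fin_cases j <;> simp

end BoundaryMaps

section Extensions
variable {H V : Type*} [NormedAddCommGroup H] [InnerProductSpace ℂ H] [CompleteSpace H]
  [NormedAddCommGroup V] [InnerProductSpace ℂ V] [CompleteSpace V]

/-- `R = (-A + z)⁻¹` as a bounded operator. -/
def IsResolventAt (A : H →ₗ.[ℂ] H) (z : ℂ) (R : H →L[ℂ] H) : Prop :=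
  (∀ f : H, ∃ h : R f ∈ A.domain, z • R f - A ⟨R f, h⟩ = f) ∧
    ∀ v : A.domain, R (z • (v : H) - A v) = v

open Classical in
/-- The resolvent operator `(-A + z)⁻¹`, for `z` in the resolvent set of `A`. -/
def resolventOp (A : H →ₗ.[ℂ] H) (z : ℂ) : H →L[ℂ] H :=
  if h : ∃ R : H →L[ℂ] H, IsResolventAt A z R then h.choose else 0

variable {K : Submodule ℂ H}

open Classical in
/-- The bounded operator `τ (-A + z)⁻¹`, where `τ` is a linear map on a subspace that contains
the domain of `A`. -/
def traceResolvent (A : H →ₗ.[ℂ] H) (τ : K →ₗ[ℂ] V) (z : ℂ) : H →L[ℂ] V :=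
  if h : ∃ B : H →L[ℂ] V, ∀ f : H, ∃ hf : resolventOp A z f ∈ K,
    B f = τ ⟨resolventOp A z f, hf⟩ then h.choose else 0

/-- `G_z = (τ (-A + z̄)⁻¹)*`. -/
def gammaField (A : H →ₗ.[ℂ] H) (τ : K →ₗ[ℂ] V) (z : ℂ) : V →L[ℂ] H :=
  ContinuousLinearMap.adjoint (traceResolvent A τ (starRingEnd ℂ z))

open Classical in
/-- The operator `τ G_z`. -/
def traceGamma (A : H →ₗ.[ℂ] H) (τ : K →ₗ[ℂ] V) (z : ℂ) : V →ₗ[ℂ] V :=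
  if h : ∃ T : V →ₗ[ℂ] V, ∀ ξ : V, ∃ hξ : gammaField A τ z ξ ∈ K,
    T ξ = τ ⟨gammaField A τ z ξ, hξ⟩ then h.choose else 0

/-- `Θ - Π τ G_z Π`, an operator in `ran Π`. -/
def kreinMap (A : H →ₗ.[ℂ] H) (τ : K →ₗ[ℂ] V) (P : V →ₗ[ℂ] V)
    (Θ : LinearMap.range P →ₗ[ℂ] LinearMap.range P) (z : ℂ) :
    Module.End ℂ (LinearMap.range P) :=
  Θ - (P.rangeRestrict ∘ₗ traceGamma A τ z) ∘ₗ (LinearMap.range P).subtype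

/-- `(-A + z)⁻¹ + G_z Π (Θ - Π τ G_z Π)⁻¹ Π G_{z̄}*`, where `Π` stands both for the surjection onto
`ran Π` and for the injection of `ran Π`. -/
def kreinResolvent (A : H →ₗ.[ℂ] H) (τ : K →ₗ[ℂ] V) (P : V →ₗ[ℂ] V)
    (Θ : LinearMap.range P →ₗ[ℂ] LinearMap.range P) (z : ℂ) : H →ₗ[ℂ] H :=
  (resolventOp A z).toLinearMap +
    ((gammaField A τ z).toLinearMap ∘ₗ (LinearMap.range P).subtype) ∘ₗ
      Ring.inverse (kreinMap A τ P Θ z) ∘ₗ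
        (P.rangeRestrict ∘ₗ
          (ContinuousLinearMap.adjoint (gammaField A τ (starRingEnd ℂ z))).toLinearMap)

/-- The operator `A_{Π,Θ}` with `(-A_{Π,Θ} + z)⁻¹ = R`, where `R` is given by `kreinResolvent`: its
graph consists of the pairs `(R f, z R f - f)`. -/
def extension (A : H →ₗ.[ℂ] H) (τ : K →ₗ[ℂ] V) (P : V →ₗ[ℂ] V)
    (Θ : LinearMap.range P →ₗ[ℂ] LinearMap.range P) (z : ℂ) : H →ₗ.[ℂ] H :=
  (LinearMap.range ((kreinResolvent A τ P Θ z).prod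
    (z • kreinResolvent A τ P Θ z - LinearMap.id))).toLinearPMap

/-- `P` is an orthogonal projector and `Θ` is a symmetric operator in its range. -/
def IsParameterPair (P : V →ₗ[ℂ] V) (Θ : LinearMap.range P →ₗ[ℂ] LinearMap.range P) : Prop :=
  P.IsSymmetricProjection ∧ Θ.IsSymmetric

/-- The boundary condition `ρΨ ∈ ran Π`, `Π τ Ψ = Θ ρ Ψ`. -/
def BoundaryCondition (τ ρ : K →ₗ[ℂ] V) (P : V →ₗ[ℂ] V)
    (Θ : LinearMap.range P →ₗ[ℂ] LinearMap.range P) (Ψ : K) : Prop :=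
  ∃ h : ρ Ψ ∈ LinearMap.range P, P (τ Ψ) = Θ ⟨ρ Ψ, h⟩

end Extensions

section PointInteractions
variable {n : ℕ} (Y : Fin n → ℝ)

/-- The Dirac operator with point interactions `D_{Π,Θ}` in `L²(ℝ; ℂ²)`, given by its resolvent
at `z`. -/
def diracExt (P : EuclideanSpace ℂ (Fin n × Fin 2) →ₗ[ℂ] EuclideanSpace ℂ (Fin n × Fin 2))
    (Θ : LinearMap.range P →ₗ[ℂ] LinearMap.range P) (z : ℂ) : L2 C2 →ₗ.[ℂ] L2 C2 :=
  extension (diracOp univ) (tauD Y) P Θ z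

/-- The Schrödinger operator with point interactions `H_{Π,Θ}` in `L²(ℝ)`, given by its resolvent
at `z`. -/
def schrodingerExt (P : EuclideanSpace ℂ (Fin n × Fin 2) →ₗ[ℂ] EuclideanSpace ℂ (Fin n × Fin 2))
    (Θ : LinearMap.range P →ₗ[ℂ] LinearMap.range P) (z : ℂ) : L2 ℂ →ₗ.[ℂ] L2 ℂ :=
  extension (schrodingerOp ℂ univ) (tauH Y) P Θ z

/-- The Schrödinger operator with point interactions `Ĥ_{Π̂,Θ̂}` in `L²(ℝ; ℂ²)`, given by its
resolvent at `z`. -/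
def schrodingerExtC2
    (P : EuclideanSpace ℂ (Fin 2 × Fin n × Fin 2) →ₗ[ℂ] EuclideanSpace ℂ (Fin 2 × Fin n × Fin 2))
    (Θ : LinearMap.range P →ₗ[ℂ] LinearMap.range P) (z : ℂ) : L2 C2 →ₗ.[ℂ] L2 C2 :=
  extension (schrodingerOp C2 univ) (tauHH Y) P Θ z

end PointInteractions
end PointInteraction
end

open PointInteraction

/-!
The three operators are instances of one statement on boundary triples, `IsBoundaryTriple`: an
operator `Amax` with domain `K` and maps `τ, ρ : K → V` into a space of finite dimension, such that
Green's identity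
`⟨Amax u, v⟩ - ⟨u, Amax v⟩ = ⟨ρ u, τ v⟩ - ⟨τ u, ρ v⟩` holds, `ρ` is onto, and the restriction `A` of
`Amax` to the kernel of `ρ` has every non-real `z` in its resolvent set.

For each `ξ` there is exactly one solution of `Amax u = z u`, `ρ u = ξ`, and by Green's identity it
is `G_z ξ` (`IsBoundaryTriple.gammaField_eigen`); in particular `τ (-A + z)⁻¹` is bounded, being the
adjoint of a linear map on a space of finite dimension, so no trace inequality is needed. Green's
identity for `u = G_z q` also shows that `Θ - Π τ G_z Π` is injective, hence invertible
(`IsBoundaryTriple.isUnit_kreinMap`). Now a function in `K` has the form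
`ψ = (-A + z)⁻¹ f + G_z q` with `f = (z - Amax) ψ` and `q = ρ ψ`, and the boundary condition on `ψ` is
the equation `(Θ - Π τ G_z Π) q = Π τ (-A + z)⁻¹ f`, that is, Krein's formula
(`IsBoundaryTriple.extension_spec`).

It remains to produce the triples. Green's identity comes from integration by parts on a line with
finitely many singular points (`inner_deriv_add_inner`). The same formula, tested against smooth
functions, shows that a function without jumps is in `H¹(ℝ)`, and that the free operators
`-i S d/dx + M` with `S` a self-adjoint involution coincide with their adjoints; their non-real
resolvents then exist (`IsSelfAdjointOp.exists_resolvent`). This settles the Dirac operator. For the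
Schrödinger operator one factors `z + d²/dx² = -(k - p)(-k - p)` with `p = -i d/dx` and `k² = z`
(`exists_resolvent_schrodingerOp`), so that no estimate of `f'` by `f` and `f''` is needed.
-/

noncomputable section
namespace PointInteraction

/-! ### Krein's formula and boundary conditions -/

section KreinFormula
variable {H V : Type*} [NormedAddCommGroup H] [InnerProductSpace ℂ H]
  [NormedAddCommGroup V] [InnerProductSpace ℂ V]
  {K : Submodule ℂ H} {A : H →ₗ.[ℂ] H} {Amax : K →ₗ[ℂ] H} {τ ρ : K →ₗ[ℂ] V}

theorem IsResolventAt.resolventOp {z : ℂ} (h : ∃ R : H →L[ℂ] H, IsResolventAt A z R) :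
    IsResolventAt A z (resolventOp A z) := by
  rw [PointInteraction.resolventOp, dif_pos h]
  exact h.choose_spec

/-- The maps `τ, ρ : K → V` form a boundary triple for the operator `Amax` with domain `K`, in which
the restriction of `Amax` to `ker ρ` is `A`, an operator with all non-real numbers in its resolvent
set. -/
structure IsBoundaryTriple (A : H →ₗ.[ℂ] H) (Amax : K →ₗ[ℂ] H) (τ ρ : K →ₗ[ℂ] V) : Prop where
  resolvent : ∀ z : ℂ, z.im ≠ 0 → ∃ R : H →L[ℂ] H, IsResolventAt A z R
  domain_le : A.domain ≤ K
  mem_domain : ∀ u : K, (u : H) ∈ A.domain ↔ ρ u = 0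
  apply_eq : ∀ (u : K) (h : (u : H) ∈ A.domain), A ⟨u, h⟩ = Amax u
  green : ∀ u v : K, ⟪Amax u, (v : H)⟫_ℂ - ⟪(u : H), Amax v⟫_ℂ = ⟪ρ u, τ v⟫_ℂ - ⟪τ u, ρ v⟫_ℂ
  surjective : Function.Surjective ρ

namespace IsBoundaryTriple
variable (hT : IsBoundaryTriple A Amax τ ρ) {z : ℂ} (hz : z.im ≠ 0)
include hT hz

theorem resolventOp_mem (f : H) : ∃ h : resolventOp A z f ∈ K, ρ ⟨resolventOp A z f, h⟩ = 0 ∧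
    Amax ⟨resolventOp A z f, h⟩ = z • resolventOp A z f - f := by
  obtain ⟨h1, h2⟩ := (IsResolventAt.resolventOp (hT.resolvent z hz)).1 f
  refine ⟨hT.domain_le h1, (hT.mem_domain _).1 h1, ?_⟩
  rw [← hT.apply_eq _ h1]
  nth_rewrite 4 [← h2]
  abel

theorem resolventOp_apply (u : K) (hu : ρ u = 0) :
    resolventOp A z (z • (u : H) - Amax u) = u := by
  have h := (IsResolventAt.resolventOp (hT.resolvent z hz)).2 ⟨u, (hT.mem_domain u).2 hu⟩
  rwa [hT.apply_eq] at h

/-- `u` with `Amax u = z u` vanishes when `ρ u = 0`, as `z` is in the resolvent set of `A`. -/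
theorem eq_zero_of_eigen {u : K} (hu : Amax u = z • (u : H)) (hρ : ρ u = 0) : u = 0 := by
  have h := hT.resolventOp_apply hz u hρ
  rw [hu, sub_self, map_zero] at h
  exact Subtype.ext h.symm

/-- `w - R_z (z - Amax) w` solves `Amax u = z u` and has the boundary value `ρ u = ρ w`. -/
theorem exists_eigen (ξ : V) : ∃ u : K, Amax u = z • (u : H) ∧ ρ u = ξ := by
  obtain ⟨w, rfl⟩ := hT.surjective ξ
  obtain ⟨h, h1, h2⟩ := hT.resolventOp_mem hz (z • (w : H) - Amax w)
  refine ⟨w - ⟨_, h⟩, ?_, ?_⟩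
  · rw [map_sub, h2, Submodule.coe_sub, smul_sub]
    abel
  · rw [map_sub, h1, sub_zero]

theorem exists_eigenMap : ∃ U : V →ₗ[ℂ] K, ∀ ξ, Amax (U ξ) = z • (U ξ : H) ∧ ρ (U ξ) = ξ := by
  choose u hu using hT.exists_eigen hz
  have key : ∀ {v w : K}, Amax v = z • (v : H) → Amax w = z • (w : H) → ρ v = ρ w → v = w := by
    intro v w hv hw h
    refine sub_eq_zero.1 (hT.eq_zero_of_eigen hz ?_ ?_)
    · rw [map_sub, hv, hw, Submodule.coe_sub, smul_sub]
    · rw [map_sub, h, sub_self]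
  refine ⟨{ toFun := u, map_add' := fun ξ η => ?_, map_smul' := fun c ξ => ?_ }, hu⟩
  · refine key (hu _).1 ?_ ?_
    · rw [map_add, (hu ξ).1, (hu η).1, Submodule.coe_add, smul_add]
    · rw [map_add, (hu _).2, (hu _).2, (hu _).2]
  · refine key (hu _).1 ?_ ?_
    · rw [RingHom.id_apply, map_smul, (hu ξ).1, Submodule.coe_smul, smul_comm]
    · rw [RingHom.id_apply, map_smul, (hu _).2, (hu _).2]

/-- Green's identity for a solution `u` of `Amax u = z̄ u` and the function `v = R_z f`. -/
theorem inner_eigen {u : K} (hu : Amax u = (starRingEnd ℂ z) • (u : H)) (f : H)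
    (h : resolventOp A z f ∈ K) : ⟪(u : H), f⟫_ℂ = ⟪ρ u, τ ⟨resolventOp A z f, h⟩⟫_ℂ := by
  obtain ⟨_, h1, h2⟩ := hT.resolventOp_mem hz f
  have hg := hT.green u ⟨resolventOp A z f, h⟩
  rw [h1, h2, hu, inner_zero_right, sub_zero, inner_smul_left, inner_sub_right,
    inner_smul_right, Complex.conj_conj] at hg
  rw [← hg]
  ring

variable [CompleteSpace H] [CompleteSpace V] [FiniteDimensional ℂ V]

theorem traceResolvent_apply (f : H) (h : resolventOp A z f ∈ K) :
    traceResolvent A τ z f = τ ⟨resolventOp A z f, h⟩ := by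
  have hz' : ((starRingEnd ℂ z).im) ≠ 0 := by simpa using hz
  -- `τ R_z` is the adjoint of the solution map of `Amax u = z̄ u`, `ρ u = ξ`; the latter is
  -- continuous because `V` has finite dimension.
  have hex : ∃ B : H →L[ℂ] V, ∀ f : H, ∃ hf : resolventOp A z f ∈ K,
      B f = τ ⟨resolventOp A z f, hf⟩ := by
    obtain ⟨U, hU⟩ := hT.exists_eigenMap hz'
    refine ⟨ContinuousLinearMap.adjoint (LinearMap.toContinuousLinearMap (K.subtype ∘ₗ U)),
      fun f => ?_⟩
    obtain ⟨hf, -, -⟩ := hT.resolventOp_mem hz f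
    refine ⟨hf, ext_inner_left ℂ fun ξ => ?_⟩
    rw [ContinuousLinearMap.adjoint_inner_right]
    have := hT.inner_eigen hz (hU ξ).1 f hf
    rw [(hU ξ).2] at this
    exact this
  rw [traceResolvent, dif_pos hex]
  obtain ⟨_, h2⟩ := hex.choose_spec f
  exact h2

/-- `G_z` inverts `ρ` on the solutions of `Amax u = z u`. -/
theorem gammaField_eigen {u : K} (hu : Amax u = z • (u : H)) : gammaField A τ z (ρ u) = u := by
  have hz' : ((starRingEnd ℂ z).im) ≠ 0 := by simpa using hz
  refine ext_inner_right ℂ fun f => ?_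
  obtain ⟨hf, -, -⟩ := hT.resolventOp_mem hz' f
  rw [gammaField, ContinuousLinearMap.adjoint_inner_left, hT.traceResolvent_apply hz' f hf,
    hT.inner_eigen hz' (by rw [Complex.conj_conj]; exact hu) f hf]

theorem gammaField_mem (ξ : V) : ∃ h : gammaField A τ z ξ ∈ K,
    Amax ⟨gammaField A τ z ξ, h⟩ = z • gammaField A τ z ξ ∧ ρ ⟨gammaField A τ z ξ, h⟩ = ξ := by
  obtain ⟨u, hu, rfl⟩ := hT.exists_eigen hz ξ
  have h := hT.gammaField_eigen hz hu
  have h' : gammaField A τ z (ρ u) ∈ K := h ▸ u.2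
  have e : (⟨gammaField A τ z (ρ u), h'⟩ : K) = u := Subtype.ext h
  exact ⟨h', by rw [e, h, hu], by rw [e]⟩

theorem traceGamma_apply (ξ : V) (h : gammaField A τ z ξ ∈ K) :
    traceGamma A τ z ξ = τ ⟨gammaField A τ z ξ, h⟩ := by
  have hex : ∃ T : V →ₗ[ℂ] V, ∀ ξ : V, ∃ hξ : gammaField A τ z ξ ∈ K,
      T ξ = τ ⟨gammaField A τ z ξ, hξ⟩ := by
    have hm : ∀ ξ, gammaField A τ z ξ ∈ K := fun ξ => (hT.gammaField_mem hz ξ).1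
    exact ⟨τ ∘ₗ (gammaField A τ z).toLinearMap.codRestrict K hm, fun ξ => ⟨hm ξ, rfl⟩⟩
  rw [traceGamma, dif_pos hex]
  obtain ⟨_, h2⟩ := hex.choose_spec ξ
  exact h2

variable {P : V →ₗ[ℂ] V} {Θ : LinearMap.range P →ₗ[ℂ] LinearMap.range P}

/-- The operator `Θ - Π τ G_z Π` is injective: if it annihilates `q`, then `u = G_z q` satisfies
`Π τ u = Θ q`, and Green's identity gives `(z̄ - z) ‖u‖² = ⟨q, Θ q⟩ - ⟨Θ q, q⟩ = 0`. -/
theorem isUnit_kreinMap (hP : IsParameterPair P Θ) : IsUnit (kreinMap A τ P Θ z) := by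
  rw [Module.End.isUnit_iff]
  have hinj : Function.Injective (kreinMap A τ P Θ z) := by
    rw [← LinearMap.ker_eq_bot, LinearMap.ker_eq_bot']
    intro q hq
    obtain ⟨h, h1, h2⟩ := hT.gammaField_mem hz (q : V)
    have h3 : ((Θ q : LinearMap.range P) : V) = P (τ ⟨gammaField A τ z q, h⟩) := by
      have := congrArg Subtype.val (sub_eq_zero.1 hq)
      simpa [hT.traceGamma_apply hz _ h] using this
    set u : K := ⟨gammaField A τ z q, h⟩ with hu
    have hPq : P (q : V) = q := by
      obtain ⟨w, hw⟩ := q.2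
      rw [← hw]
      exact LinearMap.congr_fun hP.1.isIdempotentElem w
    have e1 : ⟪(q : V), τ u⟫_ℂ = ⟪(q : V), ((Θ q : LinearMap.range P) : V)⟫_ℂ := by
      rw [h3, ← hP.1.isSymmetric, hPq]
    have e2 : ⟪τ u, (q : V)⟫_ℂ = ⟪((Θ q : LinearMap.range P) : V), (q : V)⟫_ℂ := by
      rw [h3, hP.1.isSymmetric, hPq]
    have e3 : ⟪((Θ q : LinearMap.range P) : V), (q : V)⟫_ℂ =
        ⟪(q : V), ((Θ q : LinearMap.range P) : V)⟫_ℂ := hP.2 q q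
    have hg := hT.green u u
    have h1' : Amax u = z • (u : H) := h1
    rw [h2, e1, e2, e3, sub_self, h1', inner_smul_left, inner_smul_right, ← sub_mul] at hg
    have hzz : (starRingEnd ℂ z) - z ≠ 0 := fun h0 =>
      hz (Complex.conj_eq_iff_im.1 (sub_eq_zero.1 h0))
    have hu0 : (u : H) = 0 := inner_self_eq_zero.1 ((mul_eq_zero.1 hg).resolve_left hzz)
    have : u = 0 := Subtype.ext hu0
    rw [this, map_zero] at h2
    exact Subtype.ext h2.symm
  exact ⟨hinj, LinearMap.injective_iff_surjective.1 hinj⟩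

/-- With `q = (Θ - Π τ G_z Π)⁻¹ Π τ R_z f` Krein's formula reads `ψ = R_z f + G_z q`. -/
theorem kreinResolvent_apply (hP : IsParameterPair P Θ) (f : H) (h : resolventOp A z f ∈ K) :
    ∃ q : LinearMap.range P,
      kreinMap A τ P Θ z q = P.rangeRestrict (τ ⟨resolventOp A z f, h⟩) ∧
      kreinResolvent A τ P Θ z f = resolventOp A z f + gammaField A τ z q := by
  have hz' : ((starRingEnd ℂ z).im) ≠ 0 := by simpa using hz
  refine ⟨Ring.inverse (kreinMap A τ P Θ z)
    (P.rangeRestrict (τ ⟨resolventOp A z f, h⟩)), ?_, ?_⟩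
  · rw [← Module.End.mul_apply, Ring.mul_inverse_cancel _ (hT.isUnit_kreinMap hz hP),
      Module.End.one_apply]
  · have e : ContinuousLinearMap.adjoint (gammaField A τ (starRingEnd ℂ z)) =
        traceResolvent A τ z := by
      rw [gammaField, ContinuousLinearMap.adjoint_adjoint, Complex.conj_conj]
    rw [← hT.traceResolvent_apply hz f h, kreinResolvent, e]
    rfl

theorem kreinMap_apply (q : LinearMap.range P) (h : gammaField A τ z q ∈ K) :
    kreinMap A τ P Θ z q = Θ q - P.rangeRestrict (τ ⟨gammaField A τ z q, h⟩) := by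
  rw [← hT.traceGamma_apply hz _ h]
  rfl

/-- The graph of the extension is the set of pairs `(ψ, Amax ψ)` with `ψ` subject to the boundary
condition. -/
theorem mem_graph_kreinResolvent (hP : IsParameterPair P Θ) (p : H × H) :
    p ∈ LinearMap.range ((kreinResolvent A τ P Θ z).prod
      (z • kreinResolvent A τ P Θ z - LinearMap.id)) ↔
    ∃ h : p.1 ∈ K, BoundaryCondition τ ρ P Θ ⟨p.1, h⟩ ∧ p.2 = Amax ⟨p.1, h⟩ := by
  constructor
  · rintro ⟨f, rfl⟩
    obtain ⟨h, h1, h2⟩ := hT.resolventOp_mem hz f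
    obtain ⟨q, hq1, hq2⟩ := hT.kreinResolvent_apply hz hP f h
    obtain ⟨hG, hG1, hG2⟩ := hT.gammaField_mem hz (q : V)
    have hK : kreinResolvent A τ P Θ z f ∈ K := hq2 ▸ K.add_mem h hG
    have e : (⟨kreinResolvent A τ P Θ z f, hK⟩ : K) =
        ⟨resolventOp A z f, h⟩ + ⟨gammaField A τ z q, hG⟩ := Subtype.ext hq2
    have hρ : ρ ⟨kreinResolvent A τ P Θ z f, hK⟩ = q := by rw [e, map_add, h1, hG2, zero_add]
    refine ⟨hK, ⟨hρ.symm ▸ q.2, ?_⟩, ?_⟩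
    · have e' : (⟨ρ ⟨kreinResolvent A τ P Θ z f, hK⟩, hρ.symm ▸ q.2⟩ : LinearMap.range P) = q :=
        Subtype.ext hρ
      change P (τ ⟨kreinResolvent A τ P Θ z f, hK⟩) =
        (Θ ⟨ρ ⟨kreinResolvent A τ P Θ z f, hK⟩, _⟩ : LinearMap.range P)
      rw [e']
      rw [hT.kreinMap_apply hz q hG] at hq1
      have := congrArg Subtype.val (sub_eq_iff_eq_add.1 hq1)
      rw [this, e, map_add, map_add]
      rfl
    · change z • kreinResolvent A τ P Θ z f - f = Amax ⟨kreinResolvent A τ P Θ z f, hK⟩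
      rw [e, map_add, h2, hG1, hq2, smul_add]
      abel
  · rintro ⟨h, ⟨hρ, hb⟩, h2⟩
    obtain ⟨ψ, w⟩ := p
    simp only at h h2 hρ hb
    subst h2
    set q : LinearMap.range P := ⟨ρ ⟨ψ, h⟩, hρ⟩ with hqdef
    set f : H := z • ψ - Amax ⟨ψ, h⟩ with hf
    obtain ⟨hR, hR1, hR2⟩ := hT.resolventOp_mem hz f
    -- `ψ - R_z f` solves `Amax u = z u`, hence equals `G_z ρ ψ`.
    have hG : gammaField A τ z (q : V) = ψ - resolventOp A z f := by
      have := hT.gammaField_eigen hz (u := ⟨ψ, h⟩ - ⟨resolventOp A z f, hR⟩) (by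
        rw [map_sub, hR2, Submodule.coe_sub, smul_sub]
        simp only [hf]
        abel)
      rwa [map_sub, hR1, sub_zero] at this
    have hGK : gammaField A τ z (q : V) ∈ K := hG ▸ K.sub_mem h hR
    have hGe : (⟨gammaField A τ z (q : V), hGK⟩ : K) = ⟨ψ, h⟩ - ⟨resolventOp A z f, hR⟩ :=
      Subtype.ext hG
    obtain ⟨q', hq1, hq2⟩ := hT.kreinResolvent_apply hz hP f hR
    have hqq : q' = q := by
      refine ((Module.End.isUnit_iff _).1 (hT.isUnit_kreinMap hz hP)).1 ?_
      rw [hq1, hT.kreinMap_apply hz q hGK, hGe]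
      refine Subtype.ext ?_
      change P (τ _) = ((Θ q : LinearMap.range P) : V) - P (τ _)
      rw [← hb, map_sub τ, map_sub P]
      abel
    have hkr : kreinResolvent A τ P Θ z f = ψ := by
      rw [hq2, hqq, hG]
      abel
    refine ⟨f, Prod.ext hkr ?_⟩
    change z • kreinResolvent A τ P Θ z f - f = _
    rw [hkr, hf]
    abel

theorem extension_spec (hP : IsParameterPair P Θ) :
    (∀ ψ : H, ψ ∈ (extension A τ P Θ z).domain ↔
      ∃ h : ψ ∈ K, BoundaryCondition τ ρ P Θ ⟨ψ, h⟩) ∧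
    ∀ ψ : (extension A τ P Θ z).domain,
      ∃ h : (ψ : H) ∈ K, extension A τ P Θ z ψ = Amax ⟨ψ, h⟩ := by
  have hgr := hT.mem_graph_kreinResolvent hz hP
  constructor
  · intro ψ
    constructor
    · rintro ⟨p, hp, rfl⟩
      obtain ⟨h, hb, -⟩ := (hgr p).1 hp
      exact ⟨h, hb⟩
    · rintro ⟨h, hb⟩
      exact ⟨(ψ, Amax ⟨ψ, h⟩), (hgr _).2 ⟨h, hb, rfl⟩, rfl⟩
  · intro ψ
    have hm := Submodule.mem_graph_toLinearPMap (g := LinearMap.range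
      ((kreinResolvent A τ P Θ z).prod (z • kreinResolvent A τ P Θ z - LinearMap.id)))
      (fun p hp hp1 => by
        obtain ⟨h, -, h2⟩ := (hgr p).1 hp
        have : (⟨p.1, h⟩ : K) = 0 := Subtype.ext hp1
        rw [h2, this, map_zero]) ψ
    obtain ⟨h, -, h2⟩ := (hgr _).1 hm
    exact ⟨h, h2⟩

end IsBoundaryTriple
end KreinFormula

/-! ### Resolvents of self-adjoint operators -/

section SelfAdjointResolvent
variable {H : Type*} [NormedAddCommGroup H] [InnerProductSpace ℂ H] [CompleteSpace H]
  {A : H →ₗ.[ℂ] H}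

/-- `A` coincides with its adjoint: the graph of `A` consists of the pairs `(f, g)` with
`⟨A v, f⟩ = ⟨v, g⟩` for all `v` in the domain of `A`. -/
def IsSelfAdjointOp (A : H →ₗ.[ℂ] H) : Prop :=
  ∀ f g : H, (f, g) ∈ A.graph ↔ ∀ v : A.domain, ⟪A v, f⟫_ℂ = ⟪(v : H), g⟫_ℂ

omit [CompleteSpace H] in
theorem IsSelfAdjointOp.isClosed_graph (hA : IsSelfAdjointOp A) : IsClosed (A.graph : Set (H × H)) := by
  have e : (A.graph : Set (H × H)) = ⋂ v : A.domain, {p | ⟪A v, p.1⟫_ℂ = ⟪(v : H), p.2⟫_ℂ} := by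
    ext p
    simp only [SetLike.mem_coe, mem_iInter, mem_ofPred_eq]
    exact hA p.1 p.2
  rw [e]
  exact isClosed_iInter fun v => isClosed_eq (by fun_prop) (by fun_prop)

omit [CompleteSpace H] in
/-- For symmetric `A` one has `Im ⟨v, (z - A) v⟩ = Im z ‖v‖²`. -/
theorem IsSelfAdjointOp.norm_le (hA : IsSelfAdjointOp A) (z : ℂ) {v w : H}
    (h : (v, w) ∈ A.graph) : |z.im| * ‖v‖ ≤ ‖z • v - w‖ := by
  obtain ⟨v', rfl, rfl⟩ := (LinearPMap.mem_graph_iff A).1 h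
  have hs : ⟪A v', (v' : H)⟫_ℂ = ⟪(v' : H), A v'⟫_ℂ := (hA _ _).1 (A.mem_graph v') v'
  have him : (⟪(v' : H), A v'⟫_ℂ).im = 0 := by
    rw [← Complex.conj_eq_iff_im, inner_conj_symm, hs]
  have h1 : (⟪(v' : H), z • (v' : H) - A v'⟫_ℂ).im = z.im * ‖(v' : H)‖ ^ 2 := by
    rw [inner_sub_right, inner_smul_right, inner_self_eq_norm_sq_to_K, Complex.sub_im, him,
      sub_zero]
    simp [← Complex.ofReal_pow]
  have h2 : |z.im| * ‖(v' : H)‖ ^ 2 ≤ ‖(v' : H)‖ * ‖z • (v' : H) - A v'‖ := by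
    rw [← abs_of_nonneg (sq_nonneg ‖(v' : H)‖), ← abs_mul, ← h1]
    exact (Complex.abs_im_le_norm _).trans (norm_inner_le_norm _ _)
  rcases (norm_nonneg (v' : H)).eq_or_lt with h0 | h0
  · rw [← h0, mul_zero]
    exact norm_nonneg _
  · refine le_of_mul_le_mul_left ?_ h0
    linarith [h2]

theorem IsSelfAdjointOp.exists_resolvent (hA : IsSelfAdjointOp A) {z : ℂ} (hz : z.im ≠ 0) :
    ∃ R : H →L[ℂ] H, IsResolventAt A z R := by
  have : CompleteSpace A.graph := hA.isClosed_graph.completeSpace_coe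
  let T : A.graph →L[ℂ] H :=
    z • (ContinuousLinearMap.fst ℂ H H).comp A.graph.subtypeL -
      (ContinuousLinearMap.snd ℂ H H).comp A.graph.subtypeL
  have hT : ∀ p : A.graph, T p = z • (p : H × H).1 - (p : H × H).2 := fun _ => rfl
  have hpos : 0 < |z.im| := abs_pos.2 hz
  have hb : ∀ p : A.graph, ‖p‖ ≤ (|z.im|⁻¹ + ‖z‖ * |z.im|⁻¹ + 1) * ‖T p‖ := by
    intro p
    have h1 : ‖(p : H × H).1‖ ≤ |z.im|⁻¹ * ‖T p‖ := by
      rw [inv_mul_eq_div, le_div_iff₀ hpos, mul_comm]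
      exact hA.norm_le z p.2
    have h2 : ‖(p : H × H).2‖ ≤ ‖z‖ * (|z.im|⁻¹ * ‖T p‖) + ‖T p‖ := by
      have e : (p : H × H).2 = z • (p : H × H).1 - T p := by rw [hT]; abel
      rw [e]
      refine (norm_sub_le _ _).trans ?_
      rw [norm_smul]
      gcongr
    have h3 : 0 ≤ |z.im|⁻¹ * ‖T p‖ := by positivity
    have h4 : 0 ≤ ‖z‖ * (|z.im|⁻¹ * ‖T p‖) := by positivity
    have h5 : 0 ≤ ‖T p‖ := norm_nonneg _
    change max ‖(p : H × H).1‖ ‖(p : H × H).2‖ ≤ _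
    refine max_le ?_ ?_ <;> nlinarith
  have hanti : AntilipschitzWith (Real.toNNReal (|z.im|⁻¹ + ‖z‖ * |z.im|⁻¹ + 1)) T :=
    ContinuousLinearMap.antilipschitz_of_bound T (fun p => by
      rw [Real.coe_toNNReal _ (by positivity)]
      exact hb p)
  have hcl : IsClosed (T.range : Set H) := hanti.isClosed_range T.uniformContinuous
  have hran : T.range = ⊤ := by
    have : CompleteSpace T.range := hcl.completeSpace_coe
    rw [← Submodule.orthogonal_eq_bot_iff, Submodule.eq_bot_iff]
    intro f hf
    have hg : (f, (starRingEnd ℂ z) • f) ∈ A.graph := by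
      refine (hA _ _).2 fun v => ?_
      have h0 : ⟪z • (v : H) - A v, f⟫_ℂ = 0 :=
        (Submodule.mem_orthogonal _ _).1 hf _ ⟨⟨(v, A v), A.mem_graph v⟩, rfl⟩
      rw [inner_sub_left, inner_smul_left, sub_eq_zero] at h0
      rw [inner_smul_right, ← h0]
    have h1 := hA.norm_le (starRingEnd ℂ z) hg
    rw [sub_self, norm_zero, Complex.conj_im, abs_neg] at h1
    exact norm_eq_zero.1 (le_antisymm (nonpos_of_mul_nonpos_right h1 hpos) (norm_nonneg f))
  have hker : T.ker = ⊥ := LinearMap.ker_eq_bot.2 hanti.injective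
  let e := ContinuousLinearEquiv.ofBijective T hker hran
  refine ⟨((ContinuousLinearMap.fst ℂ H H).comp A.graph.subtypeL).comp
    (e.symm : H →L[ℂ] A.graph), fun f => ?_, fun v => ?_⟩
  · obtain ⟨v, hv1, hv2⟩ := (LinearPMap.mem_graph_iff A).1 (e.symm f).2
    have h1 : T (e.symm f) = f := e.apply_symm_apply f
    rw [hT] at h1
    have h2 : ((e.symm f : A.graph) : H × H).1 ∈ A.domain := hv1 ▸ v.2
    have h3 : A ⟨_, h2⟩ = ((e.symm f : A.graph) : H × H).2 := by
      rw [← hv2]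
      exact congrArg A (Subtype.ext hv1.symm)
    refine ⟨h2, ?_⟩
    change z • ((e.symm f : A.graph) : H × H).1 - A ⟨((e.symm f : A.graph) : H × H).1, h2⟩ = f
    rw [h3]
    exact h1
  · have h1 : e ⟨(v, A v), A.mem_graph v⟩ = z • (v : H) - A v := rfl
    rw [← h1]
    simp

end SelfAdjointResolvent

/-! ### Integration by parts for functions with finitely many jumps -/

section IntegrationByParts
variable {E : Type*} [NormedAddCommGroup E] [InnerProductSpace ℂ E]

theorem integrable_inner_prod {f g : ℝ → E} (hf : Integrable f) (hg : Integrable g) :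
    Integrable (fun p : ℝ × ℝ => ⟪f p.1, g p.2⟫_ℂ) (volume.prod volume) :=
  hf.op_fst_snd continuous_inner ⟨1, fun x y => by simpa using norm_inner_le_norm x y⟩ hg

theorem continuous_integral_Iic {G : ℝ → E} (hG : Integrable G) :
    Continuous fun x => ∫ t in Iic x, G t := by
  have e : (fun x => ∫ t in Iic x, G t) = fun x => (∫ t in Iic 0, G t) + ∫ t in (0 : ℝ)..x, G t := by
    funext y
    rw [← intervalIntegral.integral_Iic_sub_Iic (μ := volume) hG.integrableOn hG.integrableOn]
    abel
  rw [e]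
  exact continuous_const.add
    (intervalIntegral.continuous_primitive (fun _ _ => hG.intervalIntegrable) 0)

variable [CompleteSpace E]

theorem integral_inner_right {f : ℝ → E} (hf : Integrable f) (c : E) :
    ∫ x, ⟪f x, c⟫_ℂ = ⟪∫ x, f x, c⟫_ℂ := by
  rw [← inner_conj_symm, ← integral_inner hf, ← integral_conj]
  simp only [inner_conj_symm]

/-- Integration by parts for the primitives of integrable functions: both sides are the integral
of `⟨f s, g t⟩` over the plane, on the left split along the diagonal. -/
theorem integral_inner_primitive {f g : ℝ → E} (hf : Integrable f) (hg : Integrable g) :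
    Integrable (fun s => ⟪f s, ∫ t in Iic s, g t⟫_ℂ) ∧
    Integrable (fun t => ⟪∫ s in Iic t, f s, g t⟫_ℂ) ∧
    (∫ s, ⟪f s, ∫ t in Iic s, g t⟫_ℂ) + ∫ t, ⟪∫ s in Iic t, f s, g t⟫_ℂ =
      ⟪∫ s, f s, ∫ t, g t⟫_ℂ := by
  let k : ℝ × ℝ → ℂ := fun p => ⟪f p.1, g p.2⟫_ℂ
  let D : Set (ℝ × ℝ) := {p | p.2 ≤ p.1}
  have hD : MeasurableSet D := measurableSet_le measurable_snd measurable_fst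
  have hk : Integrable k (volume.prod volume) := integrable_inner_prod hf hg
  have hk1 := hk.indicator hD
  have hk2 := hk.indicator hD.compl
  have e1 : ∀ s, ∫ t, D.indicator k (s, t) = ⟪f s, ∫ t in Iic s, g t⟫_ℂ := by
    intro s
    have : ∀ t, D.indicator k (s, t) = ⟪f s, (Iic s).indicator g t⟫_ℂ := by
      intro t
      by_cases h : t ≤ s
      · rw [indicator_of_mem (show (s, t) ∈ D from h), indicator_of_mem (mem_Iic.2 h)]
      · rw [indicator_of_notMem (show (s, t) ∉ D from h), indicator_of_notMem (mt mem_Iic.1 h),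
          inner_zero_right]
    simp only [this]
    rw [integral_inner (hg.indicator measurableSet_Iic), integral_indicator measurableSet_Iic]
  have e2 : ∀ t, ∫ s, Dᶜ.indicator k (s, t) = ⟪∫ s in Iic t, f s, g t⟫_ℂ := by
    intro t
    have : ∀ s, Dᶜ.indicator k (s, t) = ⟪(Iio t).indicator f s, g t⟫_ℂ := by
      intro s
      by_cases h : s < t
      · rw [indicator_of_mem (show (s, t) ∈ Dᶜ from not_le.2 h), indicator_of_mem (mem_Iio.2 h)]
      · rw [indicator_of_notMem (show (s, t) ∉ Dᶜ from not_not.2 (not_lt.1 h)),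
          indicator_of_notMem (mt mem_Iio.1 h), inner_zero_left]
    simp only [this]
    rw [integral_inner_right (hf.indicator measurableSet_Iio), integral_indicator measurableSet_Iio,
      integral_Iic_eq_integral_Iio]
  refine ⟨hk1.integral_prod_left.congr (Eventually.of_forall e1),
    hk2.integral_prod_right.congr (Eventually.of_forall e2), ?_⟩
  have s1 := integral_prod _ hk1
  have s2 := integral_prod_symm _ hk2
  simp only [e1] at s1
  simp only [e2] at s2
  have s3 : ∫ p, k p ∂(volume.prod volume) = ⟪∫ s, f s, ∫ t, g t⟫_ℂ := by
    rw [integral_prod _ hk]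
    simp only [k]
    simp only [integral_inner hg, integral_inner_right hf]
  rw [← s1, ← s2, ← s3, ← integral_add hk1 hk2]
  simp only [indicator_self_add_compl_apply]

/-- On an interval inside `U`, a function with a distributional derivative on `U` is a primitive
of that derivative. -/
theorem exists_eq_add_primitive {U : Set ℝ} {f g : L2 E}
    (hfg : IsWeakDeriv U f g) {a b : ℝ} (hab : a < b) (hU : Ioo a b ⊆ U) :
    Integrable ((Ioo a b).indicator g) ∧
    ∃ c : E, ∀ᵐ x, x ∈ Ioo a b → f x = c + ∫ t in Iic x, (Ioo a b).indicator g t := by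
  have hlf : LocallyIntegrable (f : ℝ → E) volume :=
    (Lp.memLp f).locallyIntegrable (by norm_num)
  have hlg : LocallyIntegrable (g : ℝ → E) volume :=
    (Lp.memLp g).locallyIntegrable (by norm_num)
  have hg : IntegrableOn (g : ℝ → E) (Ioo a b) :=
    (hlg.integrableOn_isCompact isCompact_Icc).mono_set Ioo_subset_Icc_self
  have hG := hg.integrable_indicator measurableSet_Ioo
  refine ⟨hG, ?_⟩
  set G : ℝ → E := (Ioo a b).indicator g with hGdef
  have hP := continuous_integral_Iic hG
  obtain ⟨c, hc⟩ := ae_const_of_weakDeriv_zero hab (h := fun x => f x - ∫ t in Iic x, G t)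
    (hlf.sub hP.locallyIntegrable) (fun φ h1 h2 h3 => by
      have hd : Continuous (deriv φ) := h1.continuous_deriv (by simp)
      simp only [smul_sub]
      rw [integral_sub (hlf.integrable_smul_left_of_hasCompactSupport hd h2.deriv)
        (hP.locallyIntegrable.integrable_smul_left_of_hasCompactSupport hd h2.deriv),
        integral_deriv_smul_primitive hG h1 h2]
      have h4 := hfg (fun x => (φ x : ℂ)) (Complex.ofRealCLM.contDiff.comp h1)
        (h2.comp_left (g := fun x : ℝ => (x : ℂ)) (by simp))
        ((tsupport_comp_subset (g := fun x : ℝ => (x : ℂ)) (by simp) φ).trans (h3.trans hU))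
      have e1 : ∀ x, deriv (fun x => (φ x : ℂ)) x = ((deriv φ x : ℝ) : ℂ) := fun x =>
        ((((h1.differentiable (by simp)) x).hasDerivAt).ofReal_comp).deriv
      simp only [e1, Complex.coe_smul] at h4
      have e2 : ∫ x, φ x • G x = ∫ x, φ x • g x := by
        congr 1
        funext x
        by_cases hx : x ∈ Ioo a b
        · simp only [G, indicator_of_mem hx]
        · rw [image_eq_zero_of_notMem_tsupport fun h => hx (h3 h), zero_smul, zero_smul]
      rw [h4, e2, sub_self])
  refine ⟨c, ?_⟩
  filter_upwards [hc] with x hx hx'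
  rw [← hx hx', sub_add_cancel]

omit [InnerProductSpace ℂ E] [CompleteSpace E] in
theorem limRight_eq {f F : ℝ → E} (hF : Continuous F) {a b : ℝ}
    (h : ∀ᵐ x, x ∈ Ioo a b → f x = F x) {y : ℝ} (hy : y ∈ Ico a b) : limRight f y = F y := by
  refine Tendsto.limUnder_eq (Tendsto.congr' ?_
    (hF.continuousAt.mono_left (inf_le_left.trans nhdsWithin_le_nhds)))
  filter_upwards [Filter.mem_inf_of_left (Ioo_mem_nhdsGT hy.2), Filter.mem_inf_of_right h]
    with x hx hx'
  exact (hx' ⟨hy.1.trans_lt hx.1, hx.2⟩).symm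

omit [InnerProductSpace ℂ E] [CompleteSpace E] in
theorem limLeft_eq {f F : ℝ → E} (hF : Continuous F) {a b : ℝ}
    (h : ∀ᵐ x, x ∈ Ioo a b → f x = F x) {y : ℝ} (hy : y ∈ Ioc a b) : limLeft f y = F y := by
  refine Tendsto.limUnder_eq (Tendsto.congr' ?_
    (hF.continuousAt.mono_left (inf_le_left.trans nhdsWithin_le_nhds)))
  filter_upwards [Filter.mem_inf_of_left (Ioo_mem_nhdsLT hy.1), Filter.mem_inf_of_right h]
    with x hx hx'
  exact (hx' ⟨hx.1, hx.2.trans_le hy.2⟩).symm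

/-- Integration by parts on an interval without singular points. -/
theorem intervalIntegral_inner_deriv {U : Set ℝ} {f f' g g' : L2 E} (hf : IsWeakDeriv U f f')
    (hg : IsWeakDeriv U g g') {a b : ℝ} (hab : a < b) (hU : Ioo a b ⊆ U) :
    ∫ x in a..b, (⟪f' x, g x⟫_ℂ + ⟪f x, g' x⟫_ℂ) =
      ⟪limLeft f b, limLeft g b⟫_ℂ - ⟪limRight f a, limRight g a⟫_ℂ := by
  obtain ⟨iF, c, hc⟩ := exists_eq_add_primitive hf hab hU
  obtain ⟨iG, d, hd⟩ := exists_eq_add_primitive hg hab hU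
  have cF := continuous_const (y := c).add (continuous_integral_Iic iF)
  have cG := continuous_const (y := d).add (continuous_integral_Iic iG)
  rw [limLeft_eq cF hc ⟨hab, le_rfl⟩, limLeft_eq cG hd ⟨hab, le_rfl⟩,
    limRight_eq cF hc ⟨le_rfl, hab⟩, limRight_eq cG hd ⟨le_rfl, hab⟩]
  have z0 : ∀ h : ℝ → E, ∫ t in Iic a, (Ioo a b).indicator h t = 0 := fun h =>
    setIntegral_eq_zero_of_forall_eq_zero fun t ht =>
      indicator_of_notMem (fun h' => (not_lt.2 ht) h'.1) _
  have z1 : ∀ h : ℝ → E, ∫ t in Iic b, (Ioo a b).indicator h t = ∫ t, (Ioo a b).indicator h t :=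
    fun h => setIntegral_eq_integral_of_forall_compl_eq_zero fun t ht =>
      indicator_of_notMem (fun h' => ht h'.2.le) _
  simp only [Pi.add_apply, z0, z1, add_zero]
  set F := (Ioo a b).indicator (f' : ℝ → E) with hFdef
  set G := (Ioo a b).indicator (g' : ℝ → E) with hGdef
  obtain ⟨i1, i2, i3⟩ := integral_inner_primitive iF iG
  have e : ∫ x in a..b, (⟪f' x, g x⟫_ℂ + ⟪f x, g' x⟫_ℂ) =
      ∫ x, ((⟪F x, d⟫_ℂ + ⟪F x, ∫ t in Iic x, G t⟫_ℂ) +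
        (⟪c, G x⟫_ℂ + ⟪∫ t in Iic x, F t, G x⟫_ℂ)) := by
    rw [intervalIntegral.integral_of_le hab.le, integral_Ioc_eq_integral_Ioo,
      ← integral_indicator measurableSet_Ioo]
    refine integral_congr_ae ?_
    filter_upwards [hc, hd] with x hcx hdx
    by_cases hx : x ∈ Ioo a b
    · rw [indicator_of_mem hx, hcx hx, hdx hx, ← inner_add_right, ← inner_add_left,
        hFdef, hGdef, indicator_of_mem hx, indicator_of_mem hx]
    · rw [indicator_of_notMem hx, hFdef, hGdef, indicator_of_notMem hx, indicator_of_notMem hx]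
      simp
  have j1 : Integrable fun x => ⟪F x, d⟫_ℂ + ⟪F x, ∫ t in Iic x, G t⟫_ℂ := (iF.inner_const d).add i1
  have j2 : Integrable fun x => ⟪c, G x⟫_ℂ + ⟪∫ t in Iic x, F t, G x⟫_ℂ := (iG.const_inner c).add i2
  rw [e, integral_add j1 j2,
    integral_add (iF.inner_const d) i1, integral_add (iG.const_inner c) i2,
    integral_inner iG, integral_inner_right iF, inner_add_left, inner_add_right, inner_add_right,
    ← i3]
  ring

omit [CompleteSpace E] in
theorem integrable_inner_deriv (f f' g g' : L2 E) :
    Integrable fun x => ⟪f' x, g x⟫_ℂ + ⟪f x, g' x⟫_ℂ :=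
  (L2.integrable_inner f' g).add (L2.integrable_inner f g')

/-- Integration by parts on an interval that may contain some of the finitely many singular
points. -/
theorem intervalIntegral_inner_deriv_finset {U : Set ℝ} {f f' g g' : L2 E}
    (hf : IsWeakDeriv U f f') (hg : IsWeakDeriv U g g') (S : Finset ℝ) {a b : ℝ} (hab : a < b)
    (hS : ∀ s ∈ S, s ∈ Ioo a b) (hU : Ioo a b \ S ⊆ U) :
    ∫ x in a..b, (⟪f' x, g x⟫_ℂ + ⟪f x, g' x⟫_ℂ) =
      ⟪limLeft f b, limLeft g b⟫_ℂ - ⟪limRight f a, limRight g a⟫_ℂ -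
        ∑ s ∈ S, (⟪limRight f s, limRight g s⟫_ℂ - ⟪limLeft f s, limLeft g s⟫_ℂ) := by
  have hi := integrable_inner_deriv f f' g g'
  -- The points of `S` are removed from the left to the right.
  induction S using Finset.induction_on_min generalizing a with
  | empty => simpa using intervalIntegral_inner_deriv hf hg hab (by simpa using hU)
  | insert y S hy ih =>
    have hyab := hS y (Finset.mem_insert_self _ _)
    have h1 := intervalIntegral_inner_deriv hf hg hyab.1 (fun x hx => hU ⟨⟨hx.1, hx.2.trans hyab.2⟩,
      fun hxS => by
        rcases Finset.mem_insert.1 (Finset.mem_coe.1 hxS) with rfl | h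
        · exact lt_irrefl _ hx.2
        · exact lt_asymm hx.2 (hy x h)⟩)
    have h2 := ih hyab.2 (fun s hs => ⟨hy s hs, (hS s (Finset.mem_insert_of_mem hs)).2⟩)
      (fun x hx => hU ⟨⟨hyab.1.trans hx.1.1, hx.1.2⟩, fun hxS => by
        rcases Finset.mem_insert.1 (Finset.mem_coe.1 hxS) with rfl | h
        · exact lt_irrefl _ hx.1.1
        · exact hx.2 h⟩)
    rw [← intervalIntegral.integral_add_adjacent_intervals (b := y) hi.intervalIntegrable
      hi.intervalIntegrable, h1, h2, Finset.sum_insert (fun h => lt_irrefl _ (hy y h))]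
    ring

theorem ae_limLeft_limRight_eq {U : Set ℝ} {f f' : L2 E} (hf : IsWeakDeriv U f f') {a b : ℝ}
    (hU : Ioo a b ⊆ U) : ∀ᵐ x, x ∈ Ioo a b → limLeft f x = f x ∧ limRight f x = f x := by
  rcases lt_or_ge a b with hab | hab
  · obtain ⟨iF, c, hc⟩ := exists_eq_add_primitive hf hab hU
    have cF := continuous_const (y := c).add (continuous_integral_Iic iF)
    filter_upwards [hc] with x hx hx'
    rw [limLeft_eq cF hc ⟨hx'.1, hx'.2.le⟩, limRight_eq cF hc ⟨hx'.1.le, hx'.2⟩]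
    exact ⟨(hx hx').symm, (hx hx').symm⟩
  · simp [Ioo_eq_empty (not_lt.2 hab)]

theorem eq_zero_of_tendsto_atTop {q h : ℝ → ℂ} {c : ℂ} (hh : Integrable h) {a : ℝ}
    (hqh : ∀ᵐ x, a < x → q x = h x) (hq : Tendsto q atTop (𝓝 c)) : c = 0 := by
  refine IntegrableAtFilter.eq_zero_of_tendsto (μ := volume) (f := q) ⟨Ioi a, Ioi_mem_atTop a, ?_⟩
    (fun s hs => ?_) hq
  · refine hh.integrableOn.congr_fun_ae ?_
    rw [EventuallyEq, ae_restrict_iff' measurableSet_Ioi]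
    filter_upwards [hqh] with x hx hx'
    exact (hx hx').symm
  · rcases mem_atTop_sets.1 hs with ⟨b, hb⟩
    rw [← top_le_iff, ← Real.volume_Ici (a := b)]
    exact measure_mono hb

theorem eq_zero_of_tendsto_atBot {q h : ℝ → ℂ} {c : ℂ} (hh : Integrable h) {a : ℝ}
    (hqh : ∀ᵐ x, x < a → q x = h x) (hq : Tendsto q atBot (𝓝 c)) : c = 0 := by
  refine IntegrableAtFilter.eq_zero_of_tendsto (μ := volume) (f := q) ⟨Iio a, Iio_mem_atBot a, ?_⟩
    (fun s hs => ?_) hq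
  · refine hh.integrableOn.congr_fun_ae ?_
    rw [EventuallyEq, ae_restrict_iff' measurableSet_Iio]
    filter_upwards [hqh] with x hx hx'
    exact (hx hx').symm
  · rcases mem_atBot_sets.1 hs with ⟨b, hb⟩
    rw [← top_le_iff, ← Real.volume_Iic (a := b)]
    exact measure_mono hb

/-- Integration by parts on the line with finitely many singular points. The boundary terms at
infinity vanish, because `⟨f, g⟩` is integrable and has limits at `±∞`. -/
theorem inner_deriv_add_inner {S : Finset ℝ} {f f' g g' : L2 E}
    (hf : IsWeakDeriv (S : Set ℝ)ᶜ f f') (hg : IsWeakDeriv (S : Set ℝ)ᶜ g g') :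
    ⟪f', g⟫_ℂ + ⟪f, g'⟫_ℂ =
      - ∑ s ∈ S, (⟪limRight f s, limRight g s⟫_ℂ - ⟪limLeft f s, limLeft g s⟫_ℂ) := by
  have hi := integrable_inner_deriv f f' g g'
  set J := ∑ s ∈ S, (⟪limRight f s, limRight g s⟫_ℂ - ⟪limLeft f s, limLeft g s⟫_ℂ) with hJ
  obtain ⟨r, hr⟩ := S.finite_toSet.isBounded.subset_ball 0
  have hr' : ∀ s ∈ S, s ∈ Ioo (-r) r := fun s hs => by
    have := hr (Finset.mem_coe.2 hs)
    rwa [mem_ball_zero_iff, Real.norm_eq_abs, abs_lt] at this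
  let q : ℝ → ℂ := fun x => ⟪limLeft f x, limLeft g x⟫_ℂ
  let p : ℝ → ℂ := fun x => ⟪limRight f x, limRight g x⟫_ℂ
  let k : ℝ → ℂ := fun x => ⟪f' x, g x⟫_ℂ + ⟪f x, g' x⟫_ℂ
  have key : ∀ a b, a < b → a ≤ -r → r ≤ b → ∫ x in a..b, k x = q b - p a - J :=
    fun a b hab ha hb => intervalIntegral_inner_deriv_finset hf hg S hab
      (fun s hs => ⟨ha.trans_lt (hr' s hs).1, (hr' s hs).2.trans_le hb⟩) (fun x hx => hx.2)
  have hq0 : ∀ᵐ x, r < x → q x = ⟪f x, g x⟫_ℂ := by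
    have h : ∀ᵐ x, ∀ n : ℕ, x ∈ Ioo r n → q x = ⟪f x, g x⟫_ℂ := by
      rw [ae_all_iff]
      intro n
      have hU : Ioo r (n : ℝ) ⊆ (S : Set ℝ)ᶜ := fun x hx hxS => lt_asymm hx.1 (hr' x hxS).2
      filter_upwards [ae_limLeft_limRight_eq hf hU, ae_limLeft_limRight_eq hg hU] with x h1 h2 hx
      simp only [q, (h1 hx).1, (h2 hx).1]
    filter_upwards [h] with x hx hx'
    obtain ⟨n, hn⟩ := exists_nat_gt x
    exact hx n ⟨hx', hn⟩
  have hp0 : ∀ᵐ x, x < -r → p x = ⟪f x, g x⟫_ℂ := by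
    have h : ∀ᵐ x, ∀ n : ℕ, x ∈ Ioo (-(n : ℝ)) (-r) → p x = ⟪f x, g x⟫_ℂ := by
      rw [ae_all_iff]
      intro n
      have hU : Ioo (-(n : ℝ)) (-r) ⊆ (S : Set ℝ)ᶜ := fun x hx hxS => lt_asymm hx.2 (hr' x hxS).1
      filter_upwards [ae_limLeft_limRight_eq hf hU, ae_limLeft_limRight_eq hg hU] with x h1 h2 hx
      simp only [p, (h1 hx).2, (h2 hx).2]
    filter_upwards [h] with x hx hx'
    obtain ⟨n, hn⟩ := exists_nat_gt (-x)
    exact hx n ⟨by linarith, hx'⟩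
  have tq : Tendsto q atTop (𝓝 ((∫ x in Ioi (-|r| - 1), k x) + p (-|r| - 1) + J)) := by
    refine (((intervalIntegral_tendsto_integral_Ioi (-|r| - 1) hi.integrableOn
      tendsto_id).add_const (p (-|r| - 1))).add_const J).congr' ?_
    filter_upwards [Ioi_mem_atTop |r|] with x hx
    have h0 := abs_nonneg r
    have hx' : |r| < x := hx
    have h1 := key (-|r| - 1) x (by linarith) (by linarith [le_abs_self r])
      (by linarith [le_abs_self r])
    change (∫ x in (-|r| - 1)..x, k x) + p (-|r| - 1) + J = q x
    rw [h1]
    ring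
  have tp : Tendsto p atBot (𝓝 (q (|r| + 1) - J - ∫ x in Iic (|r| + 1), k x)) := by
    refine ((intervalIntegral_tendsto_integral_Iic (|r| + 1) hi.integrableOn
      tendsto_id).const_sub (q (|r| + 1) - J)).congr' ?_
    filter_upwards [Iio_mem_atBot (-|r|)] with x hx
    have h0 := abs_nonneg r
    have hx' : x < -|r| := hx
    have h1 := key x (|r| + 1) (by linarith) (by linarith [le_abs_self r])
      (by linarith [le_abs_self r])
    change q (|r| + 1) - J - (∫ x in x..(|r| + 1), k x) = p x
    rw [h1]
    ring
  have tq' : Tendsto q atTop (𝓝 0) :=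
    eq_zero_of_tendsto_atTop (L2.integrable_inner f g) hq0 tq ▸ tq
  have tp' : Tendsto p atBot (𝓝 0) :=
    eq_zero_of_tendsto_atBot (L2.integrable_inner f g) hp0 tp ▸ tp
  have t1 : Tendsto (fun x : ℝ => ∫ t in (-x)..x, k t) atTop (𝓝 (∫ t, k t)) :=
    intervalIntegral_tendsto_integral hi tendsto_neg_atTop_atBot tendsto_id
  have t2 : Tendsto (fun x : ℝ => ∫ t in (-x)..x, k t) atTop (𝓝 (0 - 0 - J)) := by
    refine ((tq'.sub (tp'.comp tendsto_neg_atTop_atBot)).sub_const J).congr' ?_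
    filter_upwards [Ioi_mem_atTop |r|] with x hx
    have h0 := abs_nonneg r
    have hx' : |r| < x := hx
    exact (key (-x) x (by linarith) (by linarith [le_abs_self r])
      (by linarith [le_abs_self r])).symm
  have := tendsto_nhds_unique t1 t2
  rw [L2.inner_def, L2.inner_def, ← integral_add (L2.integrable_inner f' g)
    (L2.integrable_inner f g')]
  rw [sub_self, zero_sub] at this
  exact this

end IntegrationByParts

/-! ### Distributional derivatives and Sobolev spaces -/

section WeakDerivative
variable {E : Type*} [NormedAddCommGroup E] [InnerProductSpace ℂ E] [CompleteSpace E]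

theorem isWeakDeriv_derivH1 {U : Set ℝ} (hU : IsOpen U) (h0 : volume Uᶜ = 0) (f : H1 E U) :
    IsWeakDeriv U (f : L2 E) (derivH1 U f) :=
  weakDeriv_spec hU h0 f

theorem IsWeakDeriv.derivH1_eq {U : Set ℝ} (hU : IsOpen U) (h0 : volume Uᶜ = 0) {f g : L2 E}
    (h : IsWeakDeriv U f g) : ∃ hf : f ∈ H1 E U, derivH1 U ⟨f, hf⟩ = g := by
  have hf : f ∈ H1 E U := mem_H1_iff.2 ⟨g, h⟩
  have h5 := (weakDerivGraph E U).sub_mem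
    (show (f, derivH1 U ⟨f, hf⟩) ∈ weakDerivGraph E U from isWeakDeriv_derivH1 hU h0 ⟨f, hf⟩)
    (show (f, g) ∈ weakDerivGraph E U from h)
  exact ⟨hf, sub_eq_zero.1 (weakDeriv_functional hU h0 _ h5 (sub_self f))⟩

omit [CompleteSpace E] in
theorem IsWeakDeriv.add_smul {U : Set ℝ} {f f' g g' : L2 E} (hf : IsWeakDeriv U f f')
    (hg : IsWeakDeriv U g g') (a b : ℂ) :
    IsWeakDeriv U (a • f + b • g : L2 E) (a • f' + b • g' : L2 E) :=
  (weakDerivGraph E U).add_mem ((weakDerivGraph E U).smul_mem a (x := (f, f')) hf)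
    ((weakDerivGraph E U).smul_mem b (x := (g, g')) hg)

theorem exists_schrodingerOp_eq {U : Set ℝ} (hU : IsOpen U) (h0 : volume Uᶜ = 0) {f f' f'' : L2 E}
    (h1 : IsWeakDeriv U f f') (h2 : IsWeakDeriv U f' f'') :
    ∃ h : f ∈ H2 E U, ((derivH2 U ⟨f, h⟩ : H1 E U) : L2 E) = f' ∧
      schrodingerOp E U ⟨f, h⟩ = -f'' := by
  obtain ⟨m1, e1⟩ := h1.derivH1_eq hU h0
  obtain ⟨m2, e2⟩ := h2.derivH1_eq hU h0
  have h : f ∈ H2 E U := mem_H2_iff.2 ⟨m1, by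
    change derivH1 U ⟨f, m1⟩ ∈ H1 E U
    rwa [e1]⟩
  have e3 : (derivH2 U ⟨f, h⟩ : H1 E U) = ⟨f', m2⟩ := Subtype.ext e1
  refine ⟨h, congrArg Subtype.val e3, ?_⟩
  change -(derivH1 U (derivH2 U ⟨f, h⟩)) = _
  rw [e3, e2]

theorem isWeakDeriv_derivH2 {U : Set ℝ} (hU : IsOpen U) (h0 : volume Uᶜ = 0) (f : H2 E U) :
    IsWeakDeriv U (f : L2 E) ((derivH2 U f : H1 E U) : L2 E) :=
  isWeakDeriv_derivH1 hU h0 (Submodule.inclusion (H2_le_H1 U) f)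

omit [CompleteSpace E] in
theorem IsWeakDeriv.mono {U U' : Set ℝ} {f g : ℝ → E} (h : IsWeakDeriv U f g) (hU : U' ⊆ U) :
    IsWeakDeriv U' f g :=
  fun φ h1 h2 h3 => h φ h1 h2 (h3.trans hU)

theorem IsWeakDeriv.limRight_eq_limLeft {U : Set ℝ} (hU : IsOpen U) {f g : L2 E}
    (h : IsWeakDeriv U f g) {y : ℝ} (hy : y ∈ U) : limRight f y = limLeft f y := by
  obtain ⟨a, b, hab, hsub⟩ := mem_nhds_iff_exists_Ioo_subset.1 (hU.mem_nhds hy)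
  obtain ⟨iF, c, hc⟩ := exists_eq_add_primitive h (hab.1.trans hab.2) hsub
  have cF := continuous_const (y := c).add (continuous_integral_Iic iF)
  rw [limLeft_eq cF hc ⟨hab.1, hab.2.le⟩, limRight_eq cF hc ⟨hab.1.le, hab.2⟩]

end WeakDerivative

/-! ### Test vectors and removable singularities -/

section TestVectors
variable {E : Type*} [NormedAddCommGroup E] [InnerProductSpace ℂ E]

/-- The element `1_B p` of `L²(ℝ; E)`, for a continuous function `p` of compact support. -/
def truncL2 (B : Set ℝ) (hB : MeasurableSet B) (p : ℝ → E) (hp : Continuous p)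
    (hc : HasCompactSupport p) : L2 E :=
  ((hp.memLp_of_hasCompactSupport hc (μ := volume) (p := 2)).indicator hB).toLp (B.indicator p)

omit [InnerProductSpace ℂ E] in
theorem coeFn_truncL2 (B : Set ℝ) (hB : MeasurableSet B) (p : ℝ → E) (hp : Continuous p)
    (hc : HasCompactSupport p) : truncL2 B hB p hp hc =ᵐ[volume] B.indicator p :=
  MemLp.coeFn_toLp _

theorem integral_smul_truncL2 (B : Set ℝ) (hB : MeasurableSet B) (p : ℝ → E) (hp : Continuous p)
    (hc : HasCompactSupport p) (φ : ℝ → ℂ) :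
    ∫ x, φ x • truncL2 B hB p hp hc x = ∫ x in B, φ x • p x := by
  rw [← integral_indicator hB]
  refine integral_congr_ae ?_
  filter_upwards [coeFn_truncL2 B hB p hp hc] with x hx
  rw [hx, indicator_smul_apply]

theorem hasDerivAt_smul_test {φ : ℝ → ℂ} {p : ℝ → E} (hφ : ContDiff ℝ ∞ φ) (hp : ContDiff ℝ ∞ p)
    (x : ℝ) : HasDerivAt (fun x => φ x • p x) (φ x • deriv p x + deriv φ x • p x) x :=
  ((hφ.differentiable (by simp)) x).hasDerivAt.smul ((hp.differentiable (by simp)) x).hasDerivAt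

variable [CompleteSpace E]

/-- The boundary term at `s` that arises in the integration by parts vanishes, as test functions on
the complement of `s` do. -/
theorem isWeakDeriv_truncL2_Ioi (s : ℝ) {p : ℝ → E} (hp : ContDiff ℝ ∞ p)
    (hc : HasCompactSupport p) :
    IsWeakDeriv {s}ᶜ (truncL2 (Ioi s) measurableSet_Ioi p hp.continuous hc)
      (truncL2 (Ioi s) measurableSet_Ioi (deriv p) (hp.continuous_deriv (by simp)) hc.deriv) := by
  intro φ h1 h2 h3
  have hd : Continuous (deriv φ) := h1.continuous_deriv (by simp)
  have hd' : Continuous (deriv p) := hp.continuous_deriv (by simp)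
  have hφs : φ s = 0 := image_eq_zero_of_notMem_tsupport fun h => h3 h rfl
  have e : deriv (fun x => φ x • p x) = fun x => φ x • deriv p x + deriv φ x • p x :=
    funext fun x => (hasDerivAt_smul_test h1 hp x).deriv
  have h := HasCompactSupport.integral_Ioi_deriv_eq (f := fun x => φ x • p x)
    ((h1.smul hp).of_le (by simp)) (h2.smul_right) s
  have i1 : Integrable fun x => φ x • deriv p x :=
    (h1.continuous.smul hd').integrable_of_hasCompactSupport h2.smul_right
  have i2 : Integrable fun x => deriv φ x • p x :=
    (hd.smul hp.continuous).integrable_of_hasCompactSupport h2.deriv.smul_right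
  rw [e, integral_add i1.integrableOn i2.integrableOn, hφs, zero_smul, neg_zero] at h
  rw [integral_smul_truncL2, integral_smul_truncL2]
  exact eq_neg_of_add_eq_zero_right h

omit [CompleteSpace E] in
theorem isWeakDeriv_truncL2_univ {p : ℝ → E} (hp : ContDiff ℝ ∞ p) (hc : HasCompactSupport p) :
    IsWeakDeriv univ (truncL2 univ MeasurableSet.univ p hp.continuous hc)
      (truncL2 univ MeasurableSet.univ (deriv p) (hp.continuous_deriv (by simp)) hc.deriv) := by
  intro φ h1 h2 h3
  have hd : Continuous (deriv φ) := h1.continuous_deriv (by simp)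
  have hd' : Continuous (deriv p) := hp.continuous_deriv (by simp)
  have i1 : Integrable fun x => φ x • deriv p x :=
    (h1.continuous.smul hd').integrable_of_hasCompactSupport h2.smul_right
  have i2 : Integrable fun x => deriv φ x • p x :=
    (hd.smul hp.continuous).integrable_of_hasCompactSupport h2.deriv.smul_right
  have i3 : Integrable fun x => φ x • p x :=
    (h1.continuous.smul hp.continuous).integrable_of_hasCompactSupport h2.smul_right
  have h := integral_eq_zero_of_hasDerivAt_of_integrable (fun x => hasDerivAt_smul_test h1 hp x)
    (i1.add i2) i3
  rw [integral_add i1 i2] at h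
  rw [integral_smul_truncL2, integral_smul_truncL2, setIntegral_univ, setIntegral_univ]
  exact eq_neg_of_add_eq_zero_right h

/-- The test vector `φ̄ e`; its inner product with `f` is `⟨e, ∫ φ f⟩`. -/
def testL2 (φ : ℝ → ℂ) (hφ : Continuous φ) (hc : HasCompactSupport φ) (e : E) : L2 E :=
  truncL2 univ MeasurableSet.univ (fun x => (starRingEnd ℂ) (φ x) • e)
    ((Complex.continuous_conj.comp hφ).smul continuous_const)
    ((hc.comp_left (g := starRingEnd ℂ) (map_zero _)).smul_right)

omit [CompleteSpace E] in
theorem coeFn_testL2 (φ : ℝ → ℂ) (hφ : Continuous φ) (hc : HasCompactSupport φ) (e : E) :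
    testL2 φ hφ hc e =ᵐ[volume] fun x => (starRingEnd ℂ) (φ x) • e := by
  have h := coeFn_truncL2 univ MeasurableSet.univ (fun x => (starRingEnd ℂ) (φ x) • e)
    ((Complex.continuous_conj.comp hφ).smul continuous_const)
    ((hc.comp_left (g := starRingEnd ℂ) (map_zero _)).smul_right)
  rwa [indicator_univ] at h

theorem inner_testL2 (φ : ℝ → ℂ) (hφ : Continuous φ) (hc : HasCompactSupport φ) (e : E)
    (f : L2 E) : ⟪testL2 φ hφ hc e, f⟫_ℂ = ⟪e, ∫ x, φ x • f x⟫_ℂ := by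
  rw [L2.inner_def, ← integral_inner (integrable_smul_L2 hφ hc f)]
  refine integral_congr_ae ?_
  filter_upwards [coeFn_testL2 φ hφ hc e] with x hx
  rw [hx, inner_smul_left, Complex.conj_conj, inner_smul_right]

omit [CompleteSpace E] in
theorem isWeakDeriv_testL2 {φ : ℝ → ℂ} (hφ : ContDiff ℝ ∞ φ) (hc : HasCompactSupport φ) (e : E) :
    IsWeakDeriv univ (testL2 φ hφ.continuous hc e)
      (testL2 (deriv φ) (hφ.continuous_deriv (by simp)) hc.deriv e) := by
  have hp : ContDiff ℝ ∞ fun x => (starRingEnd ℂ) (φ x) • e :=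
    (Complex.conjCLE.contDiff.comp hφ).smul contDiff_const
  have h := isWeakDeriv_truncL2_univ hp
    ((hc.comp_left (g := starRingEnd ℂ) (map_zero _)).smul_right)
  have e1 : deriv (fun x => (starRingEnd ℂ) (φ x) • e) =
      fun x => (starRingEnd ℂ) (deriv φ x) • e := funext fun x =>
    ((Complex.conjCLE.hasFDerivAt.comp_hasDerivAt x
      ((hφ.differentiable (by simp)) x).hasDerivAt).smul_const e).deriv
  simp only [e1] at h
  exact h

omit [CompleteSpace E] in
theorem limRight_testL2 (φ : ℝ → ℂ) (hφ : Continuous φ) (hc : HasCompactSupport φ) (e : E)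
    (y : ℝ) : limRight (testL2 φ hφ hc e) y = (starRingEnd ℂ) (φ y) • e :=
  limRight_eq (a := y) (b := y + 1) ((Complex.continuous_conj.comp hφ).smul continuous_const)
    ((coeFn_testL2 φ hφ hc e).mono fun _ hx _ => hx) ⟨le_rfl, by linarith⟩

omit [CompleteSpace E] in
theorem limLeft_testL2 (φ : ℝ → ℂ) (hφ : Continuous φ) (hc : HasCompactSupport φ) (e : E)
    (y : ℝ) : limLeft (testL2 φ hφ hc e) y = (starRingEnd ℂ) (φ y) • e :=
  limLeft_eq (a := y - 1) (b := y) ((Complex.continuous_conj.comp hφ).smul continuous_const)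
    ((coeFn_testL2 φ hφ hc e).mono fun _ hx _ => hx) ⟨by linarith, le_rfl⟩

/-- Without jumps at the finitely many singular points, the distributional derivative is the one on
the whole line: integration by parts against `φ̄ e` leaves no boundary terms. -/
theorem IsWeakDeriv.univ_of_limRight_eq {S : Finset ℝ} {f f' : L2 E}
    (hf : IsWeakDeriv (S : Set ℝ)ᶜ f f') (hS : ∀ s ∈ S, limRight f s = limLeft f s) :
    IsWeakDeriv univ f f' := by
  intro φ h1 h2 _
  refine eq_neg_of_add_eq_zero_left (ext_inner_left ℂ fun e => ?_)
  have h := inner_deriv_add_inner ((isWeakDeriv_testL2 h1 h2 e).mono (subset_univ _)) hf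
  rw [Finset.sum_eq_zero fun s hs => by
    rw [limRight_testL2, limLeft_testL2, hS s hs, sub_self], neg_zero, inner_testL2,
    inner_testL2, ← inner_add_right] at h
  rw [h, inner_zero_right]

end TestVectors

/-! ### Functions with prescribed jumps -/

section Jumps
variable {E : Type*} [NormedAddCommGroup E] [InnerProductSpace ℂ E]

omit [InnerProductSpace ℂ E] in
theorem limRight_truncL2_Ioi (s : ℝ) {p : ℝ → E} (hp : Continuous p) (hc : HasCompactSupport p) :
    limRight (truncL2 (Ioi s) measurableSet_Ioi p hp hc) s = p s := by
  refine limRight_eq (a := s) (b := s + 1) hp ?_ ⟨le_rfl, by linarith⟩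
  filter_upwards [coeFn_truncL2 (Ioi s) measurableSet_Ioi p hp hc] with x hx hx'
  rw [hx, indicator_of_mem (mem_Ioi.2 hx'.1)]

omit [InnerProductSpace ℂ E] in
theorem limLeft_truncL2_Ioi (s : ℝ) {p : ℝ → E} (hp : Continuous p) (hc : HasCompactSupport p) :
    limLeft (truncL2 (Ioi s) measurableSet_Ioi p hp hc) s = 0 := by
  refine limLeft_eq (F := fun _ => 0) (a := s - 1) (b := s) continuous_const ?_
    ⟨by linarith, le_rfl⟩
  filter_upwards [coeFn_truncL2 (Ioi s) measurableSet_Ioi p hp hc] with x hx hx'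
  rw [hx, indicator_of_notMem (s := Ioi s) (not_lt.2 hx'.2.le)]

theorem exists_contDiff_hasCompactSupport (s : ℝ) (a b : E) :
    ∃ p : ℝ → E, ContDiff ℝ ∞ p ∧ HasCompactSupport p ∧ p s = a ∧ deriv p s = b := by
  let χ : ContDiffBump s := ⟨1, 2, one_pos, one_lt_two⟩
  refine ⟨fun x => χ x • (a + (x - s) • b), χ.contDiff.smul (contDiff_const.add
    ((contDiff_id.sub contDiff_const).smul contDiff_const)), χ.hasCompactSupport.smul_right,
    ?_, ?_⟩
  · simp [χ.one_of_mem_closedBall (Metric.mem_closedBall_self zero_le_one)]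
  · have h : (fun x => χ x • (a + (x - s) • b)) =ᶠ[𝓝 s] fun x => a + (x - s) • b := by
      filter_upwards [χ.eventuallyEq_one] with x hx
      rw [hx, Pi.one_apply, one_smul]
    rw [h.deriv_eq]
    have := (((hasDerivAt_id s).sub_const s).smul_const b).const_add a
    simpa using this.deriv

variable [CompleteSpace E] {n : ℕ} {Y : Fin n → ℝ}

theorem exists_single_jump (hY : Function.Injective Y) (k : Fin n) (a b : E) :
    ∃ u : H2 E (punctured Y), ∀ j,
      jumpAt Y E j (Submodule.inclusion (H2_le_H1 _) u) = (if j = k then a else 0) ∧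
      jumpAt Y E j (derivH2 _ u) = if j = k then b else 0 := by
  obtain ⟨p, hp, hc, hpa, hpb⟩ := exists_contDiff_hasCompactSupport (Y k) a b
  have hp' : ContDiff ℝ ∞ (deriv p) := (contDiff_infty_iff_deriv.1 hp).2
  have w1 := isWeakDeriv_truncL2_Ioi (Y k) hp hc
  have w2 := isWeakDeriv_truncL2_Ioi (Y k) hp' hc.deriv
  have hsub : punctured Y ⊆ {Y k}ᶜ := compl_subset_compl.2 (singleton_subset_iff.2 ⟨k, rfl⟩)
  obtain ⟨m, e2, -⟩ := exists_schrodingerOp_eq (isOpen_punctured Y) (volume_compl_punctured Y)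
    (w1.mono hsub) (w2.mono hsub)
  refine ⟨⟨_, m⟩, fun j => ⟨?_, ?_⟩⟩
  · change limRight ((⟨_, m⟩ : H2 E (punctured Y)) : L2 E) _ -
      limLeft ((⟨_, m⟩ : H2 E (punctured Y)) : L2 E) _ = _
    by_cases h : j = k
    · subst h
      rw [if_pos rfl, limRight_truncL2_Ioi, limLeft_truncL2_Ioi, sub_zero,
        hpa]
    · rw [if_neg h, sub_eq_zero]
      exact w1.limRight_eq_limLeft isOpen_compl_singleton fun h' => h (hY h')
  · change limRight ((derivH2 _ ⟨_, m⟩ : H1 E (punctured Y)) : L2 E) _ -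
      limLeft ((derivH2 _ ⟨_, m⟩ : H1 E (punctured Y)) : L2 E) _ = _
    rw [e2]
    by_cases h : j = k
    · subst h
      rw [if_pos rfl, limRight_truncL2_Ioi, limLeft_truncL2_Ioi, sub_zero, hpb]
    · rw [if_neg h, sub_eq_zero]
      exact w2.limRight_eq_limLeft isOpen_compl_singleton fun h' => h (hY h')

/-- The jumps of a function in `H²(ℝ ∖ Y)` and of its derivative can be prescribed. -/
theorem exists_jumps (hY : Function.Injective Y) (a b : Fin n → E) :
    ∃ u : H2 E (punctured Y), ∀ j,
      jumpAt Y E j (Submodule.inclusion (H2_le_H1 _) u) = a j ∧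
      jumpAt Y E j (derivH2 _ u) = b j := by
  choose u hu using fun k => exists_single_jump (E := E) hY k (a k) (b k)
  refine ⟨∑ k, u k, fun j => ⟨?_, ?_⟩⟩
  · rw [map_sum, map_sum, Finset.sum_congr rfl fun k _ => (hu k j).1]
    simp
  · rw [map_sum, map_sum, Finset.sum_congr rfl fun k _ => (hu k j).2]
    simp

end Jumps

/-! ### Constant operators acting pointwise -/

section PointwiseMaps
variable {E : Type*} [NormedAddCommGroup E] [InnerProductSpace ℂ E] (S : E →L[ℂ] E)

/-- Pointwise application of a bounded operator in `L²(ℝ; E)`. -/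
abbrev mapL2 : L2 E →L[ℂ] L2 E := S.compLpL 2 volume

theorem coeFn_mapL2 (f : L2 E) : mapL2 S f =ᵐ[volume] fun x => S (f x) :=
  S.coeFn_compLpL f

variable {S}

theorem inner_mapL2 (hS : ∀ x y, ⟪S x, y⟫_ℂ = ⟪x, S y⟫_ℂ) (f g : L2 E) :
    ⟪mapL2 S f, g⟫_ℂ = ⟪f, mapL2 S g⟫_ℂ := by
  rw [L2.inner_def, L2.inner_def]
  refine integral_congr_ae ?_
  filter_upwards [coeFn_mapL2 S f, coeFn_mapL2 S g] with x h1 h2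
  rw [h1, h2, hS]

theorem mapL2_mapL2 (hS : ∀ x, S (S x) = x) (f : L2 E) : mapL2 S (mapL2 S f) = f := by
  refine Lp.ext ?_
  filter_upwards [coeFn_mapL2 S (mapL2 S f), coeFn_mapL2 S f] with x h1 h2
  rw [h1, h2, hS]

theorem mapL2_testL2 (φ : ℝ → ℂ) (hφ : Continuous φ) (hc : HasCompactSupport φ) (e : E) :
    mapL2 S (testL2 φ hφ hc e) = testL2 φ hφ hc (S e) := by
  refine Lp.ext ?_
  filter_upwards [coeFn_mapL2 S (testL2 φ hφ hc e), coeFn_testL2 φ hφ hc e,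
    coeFn_testL2 φ hφ hc (S e)] with x h1 h2 h3
  rw [h1, h2, h3, map_smul]

variable [CompleteSpace E]

theorem integral_smul_mapL2 {φ : ℝ → ℂ} (hφ : Continuous φ) (hc : HasCompactSupport φ)
    (f : L2 E) : ∫ x, φ x • mapL2 S f x = S (∫ x, φ x • f x) := by
  rw [← S.integral_comp_comm (integrable_smul_L2 hφ hc f)]
  refine integral_congr_ae ?_
  filter_upwards [coeFn_mapL2 S f] with x hx
  rw [hx, map_smul]

theorem IsWeakDeriv.mapL2 {U : Set ℝ} {f g : L2 E} (h : IsWeakDeriv U f g) :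
    IsWeakDeriv U (mapL2 S f) (mapL2 S g) := by
  intro φ h1 h2 h3
  rw [integral_smul_mapL2 (h1.continuous_deriv (by simp)) h2.deriv,
    integral_smul_mapL2 h1.continuous h2, h φ h1 h2 h3, map_neg]

theorem limRight_mapL2 {T : Set ℝ} (hT : T.Finite) {f : L2 E} (hf : f ∈ H1 E Tᶜ) (y : ℝ) :
    limRight (mapL2 S f) y = S (limRight f y) := by
  refine Tendsto.limUnder_eq (Tendsto.congr' ?_
    ((S.continuous.tendsto _).comp (tendsto_right hT hf y)))
  filter_upwards [Filter.mem_inf_of_right (coeFn_mapL2 S f)] with x hx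
  exact hx.symm

theorem limLeft_mapL2 {T : Set ℝ} (hT : T.Finite) {f : L2 E} (hf : f ∈ H1 E Tᶜ) (y : ℝ) :
    limLeft (mapL2 S f) y = S (limLeft f y) := by
  refine Tendsto.limUnder_eq (Tendsto.congr' ?_
    ((S.continuous.tendsto _).comp (tendsto_left hT hf y)))
  filter_upwards [Filter.mem_inf_of_right (coeFn_mapL2 S f)] with x hx
  exact hx.symm

end PointwiseMaps

/-! ### The line without finitely many points -/

section PuncturedLine
variable {E : Type*} [NormedAddCommGroup E] [InnerProductSpace ℂ E] [CompleteSpace E]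
  {n : ℕ} {Y : Fin n → ℝ}

theorem punctured_eq_compl (Y : Fin n → ℝ) :
    punctured Y = ((Finset.univ.image Y : Finset ℝ) : Set ℝ)ᶜ := by
  simp [punctured]

/-- Integration by parts on `ℝ ∖ Y` in terms of jumps and averages, by
`[f g] = [f]⟨g⟩ + ⟨f⟩[g]`. -/
theorem inner_derivH1_add_inner (hY : Function.Injective Y) (f g : H1 E (punctured Y)) :
    ⟪derivH1 (punctured Y) f, (g : L2 E)⟫_ℂ + ⟪(f : L2 E), derivH1 (punctured Y) g⟫_ℂ =
      - ∑ k, (⟪jumpAt Y E k f, averageAt Y E k g⟫_ℂ + ⟪averageAt Y E k f, jumpAt Y E k g⟫_ℂ) := by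
  have hf := isWeakDeriv_derivH1 (isOpen_punctured Y) (volume_compl_punctured Y) f
  have hg := isWeakDeriv_derivH1 (isOpen_punctured Y) (volume_compl_punctured Y) g
  rw [inner_deriv_add_inner (hf.mono (punctured_eq_compl Y).ge)
    (hg.mono (punctured_eq_compl Y).ge), Finset.sum_image hY.injOn]
  refine congrArg _ (Finset.sum_congr rfl fun k _ => ?_)
  change _ = ⟪limRight (f : L2 E) (Y k) - limLeft (f : L2 E) (Y k),
      (1 / 2 : ℂ) • (limLeft (g : L2 E) (Y k) + limRight (g : L2 E) (Y k))⟫_ℂ +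
    ⟪(1 / 2 : ℂ) • (limLeft (f : L2 E) (Y k) + limRight (f : L2 E) (Y k)),
      limRight (g : L2 E) (Y k) - limLeft (g : L2 E) (Y k)⟫_ℂ
  have h2 : (starRingEnd ℂ) (1 / 2 : ℂ) = 1 / 2 := by simp [Complex.conj_ofNat]
  simp only [inner_smul_left, inner_smul_right, inner_add_left, inner_add_right, inner_sub_left,
    inner_sub_right, h2]
  ring

/-- `H¹(ℝ)` is the kernel of the jumps in `H¹(ℝ ∖ Y)`. -/
theorem isWeakDeriv_univ_iff_jumpAt (f : H1 E (punctured Y)) :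
    IsWeakDeriv univ (f : L2 E) (derivH1 (punctured Y) f) ↔ ∀ k, jumpAt Y E k f = 0 := by
  constructor
  · intro h k
    exact sub_eq_zero.2 (h.limRight_eq_limLeft isOpen_univ (mem_univ _))
  · intro h
    have hf := isWeakDeriv_derivH1 (isOpen_punctured Y) (volume_compl_punctured Y) f
    refine (hf.mono (punctured_eq_compl Y).ge).univ_of_limRight_eq fun s hs => ?_
    obtain ⟨k, -, rfl⟩ := Finset.mem_image.1 hs
    exact sub_eq_zero.1 (h k)

theorem derivH1_punctured_eq (f : H1 E (punctured Y)) (h : (f : L2 E) ∈ H1 E univ) :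
    derivH1 (punctured Y) f = derivH1 univ ⟨f, h⟩ := by
  obtain ⟨_, h2⟩ := ((isWeakDeriv_derivH1 isOpen_univ (by simp)
    (⟨(f : L2 E), h⟩ : H1 E univ)).mono
    (subset_univ (punctured Y))).derivH1_eq (isOpen_punctured Y) (volume_compl_punctured Y)
  exact h2

theorem mem_H1_univ_iff_jumpAt (f : H1 E (punctured Y)) :
    (f : L2 E) ∈ H1 E univ ↔ ∀ k, jumpAt Y E k f = 0 := by
  rw [← isWeakDeriv_univ_iff_jumpAt]
  refine ⟨fun h => ?_, fun h => mem_H1_iff.2 ⟨_, h⟩⟩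
  rw [derivH1_punctured_eq f h]
  exact isWeakDeriv_derivH1 isOpen_univ (by simp)
    (⟨(f : L2 E), h⟩ : H1 E univ)

end PuncturedLine

/-! ### First-order operators -/

section FirstOrder
variable {E : Type*} [NormedAddCommGroup E] [InnerProductSpace ℂ E]

/-- The operator `-i S d/dx + M` on `H¹(U; E)`, where `S` acts pointwise and `M` is a bounded
operator in `L²(ℝ; E)`. -/
def firstOrderMap (S : E →L[ℂ] E) (M : L2 E →L[ℂ] L2 E) (U : Set ℝ) : H1 E U →ₗ[ℂ] L2 E :=
  (-Complex.I) • (mapL2 S).toLinearMap.comp (derivH1 U) + M.toLinearMap.comp (H1 E U).subtype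

theorem firstOrderMap_apply (S : E →L[ℂ] E) (M : L2 E →L[ℂ] L2 E) (U : Set ℝ) (u : H1 E U) :
    firstOrderMap S M U u = (-Complex.I) • mapL2 S (derivH1 U u) + M u := rfl

variable [CompleteSpace E] {S : E →L[ℂ] E} {M : L2 E →L[ℂ] L2 E}

theorem firstOrderMap_green (hS : ∀ x y, ⟪S x, y⟫_ℂ = ⟪x, S y⟫_ℂ)
    (hM : ∀ f g, ⟪M f, g⟫_ℂ = ⟪f, M g⟫_ℂ) {n : ℕ} {Y : Fin n → ℝ} (hY : Function.Injective Y)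
    (u v : H1 E (punctured Y)) :
    ⟪firstOrderMap S M (punctured Y) u, (v : L2 E)⟫_ℂ -
      ⟪(u : L2 E), firstOrderMap S M (punctured Y) v⟫_ℂ =
    ∑ k, (⟪Complex.I • S (jumpAt Y E k u), averageAt Y E k v⟫_ℂ -
      ⟪averageAt Y E k u, Complex.I • S (jumpAt Y E k v)⟫_ℂ) := by
  have hu := isWeakDeriv_derivH1 (isOpen_punctured Y) (volume_compl_punctured Y) u
  obtain ⟨hm, he⟩ := (hu.mapL2 (S := S)).derivH1_eq (isOpen_punctured Y)
    (volume_compl_punctured Y)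
  have h := inner_derivH1_add_inner hY ⟨_, hm⟩ v
  have hj : ∀ k, jumpAt Y E k ⟨_, hm⟩ = S (jumpAt Y E k u) := fun k => by
    change limRight (mapL2 S (u : L2 E)) (Y k) - limLeft (mapL2 S (u : L2 E)) (Y k) =
      S (limRight (u : L2 E) (Y k) - limLeft (u : L2 E) (Y k))
    rw [limRight_mapL2 (Set.finite_range Y) u.2, limLeft_mapL2 (Set.finite_range Y) u.2, map_sub]
  have ha : ∀ k, averageAt Y E k ⟨_, hm⟩ = S (averageAt Y E k u) := fun k => by
    change (1 / 2 : ℂ) • (limLeft (mapL2 S (u : L2 E)) (Y k) +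
      limRight (mapL2 S (u : L2 E)) (Y k)) =
      S ((1 / 2 : ℂ) • (limLeft (u : L2 E) (Y k) + limRight (u : L2 E) (Y k)))
    rw [limRight_mapL2 (Set.finite_range Y) u.2, limLeft_mapL2 (Set.finite_range Y) u.2, map_smul,
      map_add]
  simp only [hj, ha, he] at h
  rw [firstOrderMap_apply, firstOrderMap_apply, inner_add_left, inner_add_right, hM,
    add_sub_add_right_eq_sub, inner_smul_left, inner_smul_right, ← inner_mapL2 hS]
  have e1 : (starRingEnd ℂ) (-Complex.I) = Complex.I := by simp
  rw [e1, neg_mul, sub_neg_eq_add, ← mul_add, h, mul_neg, Finset.mul_sum, ← Finset.sum_neg_distrib]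
  refine Finset.sum_congr rfl fun k _ => ?_
  rw [inner_smul_left, inner_smul_right, ← hS (averageAt Y E k u), Complex.conj_I]
  ring

theorem firstOrderMap_symmetric (hS : ∀ x y, ⟪S x, y⟫_ℂ = ⟪x, S y⟫_ℂ)
    (hM : ∀ f g, ⟪M f, g⟫_ℂ = ⟪f, M g⟫_ℂ) (u v : H1 E univ) :
    ⟪firstOrderMap S M univ u, (v : L2 E)⟫_ℂ = ⟪(u : L2 E), firstOrderMap S M univ v⟫_ℂ := by
  -- Green's identity without singular points.
  have e : univ = punctured (Fin.elim0 : Fin 0 → ℝ) := by simp [punctured]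
  revert u v
  rw [e]
  intro u v
  exact sub_eq_zero.1 ((firstOrderMap_green hS hM (fun i => i.elim0) u v).trans (by simp))

theorem isSelfAdjointOp_firstOrderMap (hS : ∀ x y, ⟪S x, y⟫_ℂ = ⟪x, S y⟫_ℂ)
    (hS1 : ∀ x, S (S x) = x) (hM : ∀ f g, ⟪M f, g⟫_ℂ = ⟪f, M g⟫_ℂ) :
    IsSelfAdjointOp ⟨H1 E univ, firstOrderMap S M univ⟩ := by
  intro f g
  constructor
  · intro h v
    obtain ⟨f', rfl, rfl⟩ := (LinearPMap.mem_graph_iff _).1 h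
    exact firstOrderMap_symmetric hS hM v f'
  · intro h
    replace h : ∀ v : H1 E univ, ⟪firstOrderMap S M univ v, f⟫_ℂ = ⟪(v : L2 E), g⟫_ℂ := h
    set w : L2 E := Complex.I • mapL2 S (g - M f) with hw
    have hfw : IsWeakDeriv univ f w := by
      intro φ h1 h2 _
      refine ext_inner_left ℂ fun e => ?_
      -- The vector `v = φ̄ S e` gives `i ⟨e, ∫ φ' f⟩ = ⟨φ̄ S e, g - M f⟩`.
      obtain ⟨hm, he⟩ := (isWeakDeriv_testL2 h1 h2 (S e)).derivH1_eq isOpen_univ (by simp)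
      have h3 : ⟪firstOrderMap S M univ ⟨_, hm⟩, f⟫_ℂ =
        ⟪testL2 φ h1.continuous h2 (S e), g⟫_ℂ := h ⟨_, hm⟩
      rw [firstOrderMap_apply, he, mapL2_testL2, hS1, inner_add_left, hM, ← eq_sub_iff_add_eq,
        ← inner_sub_right, inner_smul_left, inner_testL2, ← mapL2_testL2, inner_mapL2 hS] at h3
      have h4 : ⟪testL2 φ h1.continuous h2 e, w⟫_ℂ =
          Complex.I * ⟪testL2 φ h1.continuous h2 e, mapL2 S (g - M f)⟫_ℂ := inner_smul_right _ _ _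
      rw [← h3, inner_testL2] at h4
      rw [inner_neg_right, h4]
      have e1 : (starRingEnd ℂ) (-Complex.I) = Complex.I := by simp
      rw [e1, ← mul_assoc, Complex.I_mul_I]
      ring
    obtain ⟨hm, he⟩ := hfw.derivH1_eq isOpen_univ (by simp)
    refine (LinearPMap.mem_graph_iff _).2 ⟨⟨f, hm⟩, rfl, ?_⟩
    change firstOrderMap S M univ ⟨f, hm⟩ = g
    rw [firstOrderMap_apply, he, hw, map_smul, smul_smul, mapL2_mapL2 hS1]
    simp

end FirstOrder

/-! ### The resolvent of the free Schrödinger operator -/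

section FreeSchrodinger
variable {E : Type*} [NormedAddCommGroup E] [InnerProductSpace ℂ E] [CompleteSpace E]

/-- The resolvent of the self-adjoint operator `-i d/dx`. -/
theorem exists_resolvent_deriv {k : ℂ} (hk : k.im ≠ 0) : ∃ R : L2 E →L[ℂ] L2 E,
    (∀ f, IsWeakDeriv univ (R f) (Complex.I • (k • R f - f) : L2 E)) ∧
    ∀ v v' : L2 E, IsWeakDeriv univ v v' → R (k • v + Complex.I • v') = v := by
  have hid : ∀ f : L2 E, mapL2 (ContinuousLinearMap.id ℂ E) f = f := fun f => by
    refine Lp.ext ?_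
    filter_upwards [coeFn_mapL2 (ContinuousLinearMap.id ℂ E) f] with x hx
    rw [hx]
    rfl
  have hp : ∀ u : H1 E univ, firstOrderMap (ContinuousLinearMap.id ℂ E) 0 univ u =
      (-Complex.I) • derivH1 univ u := fun u => by
    rw [firstOrderMap_apply, hid]
    simp
  obtain ⟨R, hR, hR'⟩ := (isSelfAdjointOp_firstOrderMap (S := ContinuousLinearMap.id ℂ E) (M := 0)
    (fun _ _ => rfl) (fun _ => rfl) (fun _ _ => by simp)).exists_resolvent hk
  refine ⟨R, fun f => ?_, fun v v' hv => ?_⟩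
  · obtain ⟨m, e⟩ := hR f
    replace e : k • R f - firstOrderMap (ContinuousLinearMap.id ℂ E) 0 univ ⟨R f, m⟩ = f := e
    have h := isWeakDeriv_derivH1 isOpen_univ (by simp) ⟨R f, m⟩
    have e2 : Complex.I • (k • R f - f) = derivH1 univ ⟨R f, m⟩ := by
      nth_rewrite 2 [← e]
      rw [sub_sub_cancel, hp, smul_smul]
      simp
    rw [e2]
    exact h
  · obtain ⟨m, e⟩ := hv.derivH1_eq isOpen_univ (by simp)
    have h : R (k • v - firstOrderMap (ContinuousLinearMap.id ℂ E) 0 univ ⟨v, m⟩) = v :=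
      hR' ⟨v, m⟩
    rwa [hp, e, neg_smul, sub_neg_eq_add] at h

variable (E)

/-- With `p = -i d/dx` and `k² = z` one has `z + d²/dx² = -(k - p)(-k - p)`, and `p` is
self-adjoint. -/
theorem exists_resolvent_schrodingerOp {z : ℂ} (hz : z.im ≠ 0) :
    ∃ R : L2 E →L[ℂ] L2 E, IsResolventAt (schrodingerOp E univ) z R := by
  obtain ⟨k, hk⟩ := IsAlgClosed.exists_pow_nat_eq z (n := 2) two_pos
  have hk0 : k.im ≠ 0 := by
    intro h0
    apply hz
    rw [← hk, pow_two, Complex.mul_im, h0]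
    ring
  obtain ⟨R1, hR1, hR1'⟩ := exists_resolvent_deriv (E := E) hk0
  obtain ⟨R2, hR2, hR2'⟩ := exists_resolvent_deriv (E := E) (k := -k) (by simpa using hk0)
  have hI := Complex.I_mul_I
  refine ⟨-(R2.comp R1), fun f => ?_, fun v => ?_⟩
  · have hw := hR1 f
    have hu := hR2 (R1 f)
    set w := R1 f with hwdef
    set u := R2 w with hudef
    have h1 := (hu.add_smul hu (-1) 0)
    have h2 := (hu.add_smul hw (Complex.I * k) Complex.I)
    have e1 : ((-1 : ℂ) • u + (0 : ℂ) • u : L2 E) = -u := by module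
    have e2 : ((-1 : ℂ) • (Complex.I • ((-k) • u - w)) + (0 : ℂ) • (Complex.I • ((-k) • u - w)) :
        L2 E) = (Complex.I * k) • u + Complex.I • w := by module
    rw [e1, e2] at h1
    obtain ⟨m, -, e⟩ := exists_schrodingerOp_eq isOpen_univ (by simp) h1 h2
    refine ⟨m, ?_⟩
    change z • (-u) - schrodingerOp E univ ⟨-u, m⟩ = f
    rw [e, ← hk]
    linear_combination (norm := module) (-hI) • (k ^ 2 • u + f)
  · have h1 := isWeakDeriv_derivH2 isOpen_univ (by simp) v
    have h2 := isWeakDeriv_derivH1 isOpen_univ (by simp) (derivH2 univ v)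
    have e : schrodingerOp E univ v = -(derivH1 univ (derivH2 univ v)) := rfl
    have h3 := hR1' _ _ (h1.add_smul h2 (-k) Complex.I)
    have h4 := hR2' _ _ h1
    have h5 : -(z • (v : L2 E) - schrodingerOp E univ v) =
        k • ((-k) • (v : L2 E) + Complex.I • ((derivH2 univ v : H1 E univ) : L2 E)) +
          Complex.I • ((-k) • ((derivH2 univ v : H1 E univ) : L2 E) +
            Complex.I • derivH1 univ (derivH2 univ v)) := by
      rw [e, ← hk]
      linear_combination (norm := module) (-hI) • derivH1 univ (derivH2 univ v)
    change -(R2 (R1 (z • (v : L2 E) - schrodingerOp E univ v))) = v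
    rw [← map_neg, ← map_neg, h5, h3, h4]

end FreeSchrodinger

/-! ### The boundary triple of the Dirac operator -/

section DiracTriple

/-- The Pauli matrix `σ₁` as an operator in `ℂ²`. -/
abbrev sigma1CLM : C2 →L[ℂ] C2 := Matrix.toEuclideanCLM (n := Fin 2) (𝕜 := ℂ) sigma1

/-- Pointwise multiplication by `σ₃ / 2` in `L²(ℝ; ℂ²)`. -/
abbrev massTerm : L2 C2 →L[ℂ] L2 C2 :=
  (1 / 2 : ℂ) • mapL2 (Matrix.toEuclideanCLM (n := Fin 2) (𝕜 := ℂ) sigma3)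

theorem toEuclideanCLM_symmetric {A : Matrix (Fin 2) (Fin 2) ℂ} (hA : A.IsHermitian) (x y : C2) :
    ⟪Matrix.toEuclideanCLM (n := Fin 2) (𝕜 := ℂ) A x, y⟫_ℂ =
      ⟪x, Matrix.toEuclideanCLM (n := Fin 2) (𝕜 := ℂ) A y⟫_ℂ := by
  rw [← ContinuousLinearMap.adjoint_inner_right, ← ContinuousLinearMap.star_eq_adjoint, ← map_star]
  rw [Matrix.star_eq_conjTranspose, hA.eq]

theorem isHermitian_sigma1 : sigma1.IsHermitian := by
  ext i j
  fin_cases i <;> fin_cases j <;> simp [sigma1]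

theorem isHermitian_sigma3 : sigma3.IsHermitian := by
  ext i j
  fin_cases i <;> fin_cases j <;> simp [sigma3]

theorem sigma1_symmetric (x y : C2) : ⟪sigma1CLM x, y⟫_ℂ = ⟪x, sigma1CLM y⟫_ℂ :=
  toEuclideanCLM_symmetric isHermitian_sigma1 x y

theorem sigma1_sigma1 (x : C2) : sigma1CLM (sigma1CLM x) = x := by
  rw [← mul_apply_eq_comp, ← map_mul]
  have : sigma1 * sigma1 = 1 := by
    ext i j
    fin_cases i <;> fin_cases j <;> simp [sigma1]
  rw [this, map_one, one_apply_eq_self]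

theorem massTerm_symmetric (f g : L2 C2) : ⟪massTerm f, g⟫_ℂ = ⟪f, massTerm g⟫_ℂ := by
  simp only [massTerm, _root_.smul_apply]
  rw [inner_smul_left, inner_smul_right, inner_mapL2 (toEuclideanCLM_symmetric isHermitian_sigma3)]
  simp [Complex.conj_ofNat]

theorem diracOp_eq (U : Set ℝ) : diracOp U = ⟨H1 C2 U, firstOrderMap sigma1CLM massTerm U⟩ := rfl

variable {n : ℕ} {Y : Fin n → ℝ}

theorem tauD_apply (u : H1 C2 (punctured Y)) (k : Fin n) (j : Fin 2) :
    tauD Y u (k, j) = averageAt Y C2 k u j := rfl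

theorem rhoD_apply (u : H1 C2 (punctured Y)) (k : Fin n) (j : Fin 2) :
    rhoD Y u (k, j) = (Complex.I • sigma1CLM (jumpAt Y C2 k u)) j := rfl

theorem rhoD_eq_iff (u : H1 C2 (punctured Y)) (ξ : EuclideanSpace ℂ (Fin n × Fin 2)) :
    rhoD Y u = ξ ↔ ∀ k, jumpAt Y C2 k u =
      sigma1CLM ((-Complex.I) • WithLp.toLp 2 fun j => ξ (k, j)) := by
  constructor
  · rintro rfl k
    have : (WithLp.toLp 2 fun j => rhoD Y u (k, j)) =
      Complex.I • sigma1CLM (jumpAt Y C2 k u) := rfl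
    rw [this, smul_smul, neg_mul, Complex.I_mul_I, neg_neg, one_smul, sigma1_sigma1]
  · intro h
    ext ⟨k, j⟩
    rw [rhoD_apply, h, sigma1_sigma1, smul_smul, mul_neg, Complex.I_mul_I, neg_neg, one_smul]

theorem inner_rhoD_tauD (u v : H1 C2 (punctured Y)) : ⟪rhoD Y u, tauD Y v⟫_ℂ =
    ∑ k, ⟪Complex.I • sigma1CLM (jumpAt Y C2 k u), averageAt Y C2 k v⟫_ℂ := by
  simp only [PiLp.inner_apply, Fintype.sum_prod_type, tauD_apply, rhoD_apply]

theorem isBoundaryTriple_dirac (hY : Function.Injective Y) :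
    IsBoundaryTriple (diracOp univ) (firstOrderMap sigma1CLM massTerm (punctured Y))
      (tauD Y) (rhoD Y) where
  resolvent z hz := by
    rw [diracOp_eq]
    exact (isSelfAdjointOp_firstOrderMap sigma1_symmetric sigma1_sigma1
      massTerm_symmetric).exists_resolvent hz
  domain_le := H1_univ_le _
  mem_domain u := by
    refine (mem_H1_univ_iff_jumpAt u).trans (Iff.trans ?_ (rhoD_eq_iff u 0).symm)
    refine forall_congr' fun k => ?_
    have : (WithLp.toLp 2 fun j => (0 : EuclideanSpace ℂ (Fin n × Fin 2)) (k, j)) = (0 : C2) := rfl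
    rw [this, smul_zero, map_zero]
  apply_eq u h := by
    have h' : (u : L2 C2) ∈ H1 C2 univ := h
    change firstOrderMap sigma1CLM massTerm univ ⟨u, h'⟩ = _
    rw [firstOrderMap_apply, firstOrderMap_apply, derivH1_punctured_eq u h']
  green u v := by
    rw [firstOrderMap_green sigma1_symmetric massTerm_symmetric hY u v, Finset.sum_sub_distrib,
      inner_rhoD_tauD, ← inner_conj_symm (tauD Y u), inner_rhoD_tauD, map_sum]
    simp only [inner_conj_symm]
  surjective ξ := by
    obtain ⟨u, hu⟩ := exists_jumps (E := C2) hY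
      (fun k => sigma1CLM ((-Complex.I) • WithLp.toLp 2 fun j => ξ (k, j))) 0
    exact ⟨Submodule.inclusion (H2_le_H1 _) u, (rhoD_eq_iff _ _).2 fun k => (hu k).1⟩

end DiracTriple

/-! ### The boundary triples of the Schrödinger operators -/

section SchrodingerTriple
variable {E : Type*} [NormedAddCommGroup E] [InnerProductSpace ℂ E]

/-- `f ↦ -f''` on `H²(U; E)`. -/
def schrodingerMap (E : Type*) [NormedAddCommGroup E] [InnerProductSpace ℂ E] (U : Set ℝ) :
    H2 E U →ₗ[ℂ] L2 E :=
  -((derivH1 U).comp (derivH2 U))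

theorem schrodingerMap_apply {U : Set ℝ} (u : H2 E U) :
    schrodingerMap E U u = -derivH1 U (derivH2 U u) := rfl

variable [CompleteSpace E] {n : ℕ} {Y : Fin n → ℝ}

/-- The inclusion of `H²(U; E)` in `H¹(U; E)`. -/
abbrev toH1 (U : Set ℝ) : H2 E U →ₗ[ℂ] H1 E U := Submodule.inclusion (H2_le_H1 U)

theorem schrodingerMap_green (hY : Function.Injective Y) (u v : H2 E (punctured Y)) :
    ⟪schrodingerMap E (punctured Y) u, (v : L2 E)⟫_ℂ -
      ⟪(u : L2 E), schrodingerMap E (punctured Y) v⟫_ℂ =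
    (∑ k, (⟪jumpAt Y E k (derivH2 _ u), averageAt Y E k (toH1 _ v)⟫_ℂ +
      ⟪-jumpAt Y E k (toH1 _ u), averageAt Y E k (derivH2 _ v)⟫_ℂ)) -
    ∑ k, (⟪averageAt Y E k (toH1 _ u), jumpAt Y E k (derivH2 _ v)⟫_ℂ +
      ⟪averageAt Y E k (derivH2 _ u), -jumpAt Y E k (toH1 _ v)⟫_ℂ) := by
  have h1 := inner_derivH1_add_inner hY (derivH2 _ u) (toH1 _ v)
  have h2 := inner_derivH1_add_inner hY (toH1 _ u) (derivH2 _ v)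
  have e1 : derivH1 (punctured Y) (toH1 _ v) = (derivH2 _ v : H1 E (punctured Y)) := rfl
  have e2 : derivH1 (punctured Y) (toH1 _ u) = (derivH2 _ u : H1 E (punctured Y)) := rfl
  rw [e1] at h1
  rw [e2] at h2
  rw [schrodingerMap_apply, schrodingerMap_apply]
  simp only [inner_neg_left, inner_neg_right, Finset.sum_add_distrib, Finset.sum_neg_distrib,
    Submodule.coe_inclusion] at h1 h2 ⊢
  linear_combination h2 - h1

/-- `H²(ℝ)` is the subspace of `H²(ℝ ∖ Y)` on which the jumps of `u` and `u'` vanish. -/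
theorem mem_H2_univ_iff_jumpAt (u : H2 E (punctured Y)) : (u : L2 E) ∈ H2 E univ ↔
    ∀ k, jumpAt Y E k (toH1 _ u) = 0 ∧ jumpAt Y E k (derivH2 _ u) = 0 := by
  have key : ∀ h1 : (u : L2 E) ∈ H1 E univ, derivH1 univ ⟨u, h1⟩ =
      ((derivH2 _ u : H1 E (punctured Y)) : L2 E) := fun h1 =>
    (derivH1_punctured_eq (toH1 _ u) h1).symm
  rw [forall_and, ← mem_H1_univ_iff_jumpAt, ← mem_H1_univ_iff_jumpAt, mem_H2_iff]
  constructor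
  · rintro ⟨h1, h2⟩
    exact ⟨h1, key h1 ▸ h2⟩
  · rintro ⟨h1, h2⟩
    replace h1 : (u : L2 E) ∈ H1 E univ := h1
    refine ⟨h1, ?_⟩
    change derivH1 univ ⟨u, h1⟩ ∈ H1 E univ
    rwa [key]

theorem schrodingerOp_univ_eq (u : H2 E (punctured Y)) (h : (u : L2 E) ∈ H2 E univ) :
    schrodingerOp E univ ⟨u, h⟩ = schrodingerMap E (punctured Y) u := by
  have h1 := isWeakDeriv_derivH2 isOpen_univ (by simp) (⟨(u : L2 E), h⟩ : H2 E univ)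
  have h2 := isWeakDeriv_derivH1 isOpen_univ (by simp) (derivH2 univ (⟨(u : L2 E), h⟩ : H2 E univ))
  obtain ⟨_, -, e⟩ := exists_schrodingerOp_eq (isOpen_punctured Y) (volume_compl_punctured Y)
    (h1.mono (subset_univ _)) (h2.mono (subset_univ _))
  exact e.symm

theorem rhoH_eq_iff (u : H2 ℂ (punctured Y)) (ξ : EuclideanSpace ℂ (Fin n × Fin 2)) :
    rhoH Y u = ξ ↔ ∀ k, jumpAt Y ℂ k (toH1 _ u) = -ξ (k, 1) ∧
      jumpAt Y ℂ k (derivH2 _ u) = ξ (k, 0) := by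
  constructor
  · rintro rfl k
    exact ⟨(neg_neg _).symm, rfl⟩
  · intro h
    ext ⟨k, j⟩
    fin_cases j
    · exact (h k).2
    · exact neg_eq_iff_eq_neg.2 (h k).1

theorem inner_rhoH_tauH (u v : H2 ℂ (punctured Y)) : ⟪rhoH Y u, tauH Y v⟫_ℂ =
    ∑ k, (⟪jumpAt Y ℂ k (derivH2 _ u), averageAt Y ℂ k (toH1 _ v)⟫_ℂ +
      ⟪-jumpAt Y ℂ k (toH1 _ u), averageAt Y ℂ k (derivH2 _ v)⟫_ℂ) := by
  rw [PiLp.inner_apply, Fintype.sum_prod_type]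
  exact Finset.sum_congr rfl fun k _ => Fin.sum_univ_two _

theorem isBoundaryTriple_schrodinger (hY : Function.Injective Y) :
    IsBoundaryTriple (schrodingerOp ℂ univ) (schrodingerMap ℂ (punctured Y))
      (tauH Y) (rhoH Y) where
  resolvent z hz := exists_resolvent_schrodingerOp ℂ hz
  domain_le := H2_univ_le (isOpen_punctured Y) (volume_compl_punctured Y)
  mem_domain u := by
    refine (mem_H2_univ_iff_jumpAt u).trans (Iff.trans ?_ (rhoH_eq_iff u 0).symm)
    simp
  apply_eq u h := schrodingerOp_univ_eq u h
  green u v := by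
    rw [schrodingerMap_green hY u v, inner_rhoH_tauH, ← inner_conj_symm (tauH Y u),
      inner_rhoH_tauH, map_sum]
    simp only [map_add, inner_conj_symm]
  surjective ξ := by
    obtain ⟨u, hu⟩ := exists_jumps (E := ℂ) hY (fun k => -ξ (k, 1)) (fun k => ξ (k, 0))
    exact ⟨u, (rhoH_eq_iff u ξ).2 hu⟩

theorem rhoHH_eq_iff (u : H2 C2 (punctured Y)) (ξ : EuclideanSpace ℂ (Fin 2 × Fin n × Fin 2)) :
    rhoHH Y u = ξ ↔ ∀ k, jumpAt Y C2 k (toH1 _ u) = (-WithLp.toLp 2 fun c => ξ (c, k, 1)) ∧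
      jumpAt Y C2 k (derivH2 _ u) = WithLp.toLp 2 fun c => ξ (c, k, 0) := by
  constructor
  · rintro rfl k
    refine ⟨?_, rfl⟩
    ext c
    exact (neg_neg _).symm
  · intro h
    ext ⟨c, k, j⟩
    fin_cases j
    · exact congrFun (congrArg WithLp.ofLp (h k).2) c
    · exact neg_eq_iff_eq_neg.2 (congrFun (congrArg WithLp.ofLp (h k).1) c)

theorem inner_rhoHH_tauHH (u v : H2 C2 (punctured Y)) : ⟪rhoHH Y u, tauHH Y v⟫_ℂ =
    ∑ k, (⟪jumpAt Y C2 k (derivH2 _ u), averageAt Y C2 k (toH1 _ v)⟫_ℂ +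
      ⟪-jumpAt Y C2 k (toH1 _ u), averageAt Y C2 k (derivH2 _ v)⟫_ℂ) := by
  simp only [PiLp.inner_apply, Fintype.sum_prod_type, ← Finset.sum_add_distrib]
  rw [Finset.sum_comm]
  exact Finset.sum_congr rfl fun k _ => Finset.sum_congr rfl fun c _ => Fin.sum_univ_two _

theorem isBoundaryTriple_schrodingerC2 (hY : Function.Injective Y) :
    IsBoundaryTriple (schrodingerOp C2 univ) (schrodingerMap C2 (punctured Y))
      (tauHH Y) (rhoHH Y) where
  resolvent z hz := exists_resolvent_schrodingerOp C2 hz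
  domain_le := H2_univ_le (isOpen_punctured Y) (volume_compl_punctured Y)
  mem_domain u := by
    refine (mem_H2_univ_iff_jumpAt u).trans (Iff.trans ?_ (rhoHH_eq_iff u 0).symm)
    have : ∀ k j, (WithLp.toLp 2 fun c =>
      (0 : EuclideanSpace ℂ (Fin 2 × Fin n × Fin 2)) (c, k, j)) = (0 : C2) := fun _ _ => rfl
    simp only [this, neg_zero]
  apply_eq u h := schrodingerOp_univ_eq u h
  green u v := by
    rw [schrodingerMap_green hY u v, inner_rhoHH_tauHH, ← inner_conj_symm (tauHH Y u),
      inner_rhoHH_tauHH, map_sum]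
    simp only [map_add, inner_conj_symm]
  surjective ξ := by
    obtain ⟨u, hu⟩ := exists_jumps (E := C2) hY (fun k => -WithLp.toLp 2 fun c => ξ (c, k, 1))
      (fun k => WithLp.toLp 2 fun c => ξ (c, k, 0))
    exact ⟨u, (rhoHH_eq_iff u ξ).2 hu⟩

end SchrodingerTriple

end PointInteraction
end

theorem theorem3p1 {n : ℕ} (Y : Fin n → ℝ) (hY : StrictMono Y) :
    (∀ (P : EuclideanSpace ℂ (Fin n × Fin 2) →ₗ[ℂ] EuclideanSpace ℂ (Fin n × Fin 2))
        (Θ : LinearMap.range P →ₗ[ℂ] LinearMap.range P),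
        IsParameterPair P Θ → ∀ z : ℂ, z.im ≠ 0 →
        (∀ Ψ : L2 C2, Ψ ∈ (diracExt Y P Θ z).domain ↔
          ∃ h : Ψ ∈ H1 C2 (punctured Y),
            BoundaryCondition (tauD Y) (rhoD Y) P Θ ⟨Ψ, h⟩) ∧
        ∀ Ψ : (diracExt Y P Θ z).domain,
          ∃ h : (Ψ : L2 C2) ∈ H1 C2 (punctured Y),
            diracExt Y P Θ z Ψ = diracOp (punctured Y) ⟨Ψ, h⟩) ∧
    (∀ (P : EuclideanSpace ℂ (Fin n × Fin 2) →ₗ[ℂ] EuclideanSpace ℂ (Fin n × Fin 2))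
        (Θ : LinearMap.range P →ₗ[ℂ] LinearMap.range P),
        IsParameterPair P Θ → ∀ z : ℂ, z.im ≠ 0 →
        (∀ Ψ : L2 ℂ, Ψ ∈ (schrodingerExt Y P Θ z).domain ↔
          ∃ h : Ψ ∈ H2 ℂ (punctured Y),
            BoundaryCondition (tauH Y) (rhoH Y) P Θ ⟨Ψ, h⟩) ∧
        ∀ Ψ : (schrodingerExt Y P Θ z).domain,
          ∃ h : (Ψ : L2 ℂ) ∈ H2 ℂ (punctured Y),
            schrodingerExt Y P Θ z Ψ = schrodingerOp ℂ (punctured Y) ⟨Ψ, h⟩) ∧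
    (∀ (P : EuclideanSpace ℂ (Fin 2 × Fin n × Fin 2) →ₗ[ℂ] EuclideanSpace ℂ (Fin 2 × Fin n × Fin 2))
        (Θ : LinearMap.range P →ₗ[ℂ] LinearMap.range P),
        IsParameterPair P Θ → ∀ z : ℂ, z.im ≠ 0 →
        (∀ Ψ : L2 C2, Ψ ∈ (schrodingerExtC2 Y P Θ z).domain ↔
          ∃ h : Ψ ∈ H2 C2 (punctured Y),
            BoundaryCondition (tauHH Y) (rhoHH Y) P Θ ⟨Ψ, h⟩) ∧
        ∀ Ψ : (schrodingerExtC2 Y P Θ z).domain,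
          ∃ h : (Ψ : L2 C2) ∈ H2 C2 (punctured Y),
            schrodingerExtC2 Y P Θ z Ψ = schrodingerOp C2 (punctured Y) ⟨Ψ, h⟩) := by
  exact ⟨fun P Θ hP z hz => (isBoundaryTriple_dirac hY.injective).extension_spec hz hP,
    fun P Θ hP z hz => (isBoundaryTriple_schrodinger hY.injective).extension_spec hz hP,
    fun P Θ hP z hz => (isBoundaryTriple_schrodingerC2 hY.injective).extension_spec hz hP⟩
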